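/- Let $d\ge 1$, let $A$ be a $d\times d$ integer matrix all of whose complex eigenvalues have modulus $>1$, and put $q=|\det A|$. Let $\mathcal D\subset\mathbb Z^d$ be a finite nonempty digit set, $S_t(x)=A^{-1}(x+t)$ for $t\in\mathcal D$, and let $K$ be the integral self-affine set, i.e. the unique nonempty compact $K\subset\mathbb R^d$ with $K=\bigcup_{t\in\mathcal D}S_t(K)$. Let $J\subset\mathbb R^d$ be any nonempty bounded closed set with $S_t(J)\subset J$ for all $t\in\mathcal D$. *The graph.* For a word ${\bf u}=i_1\cdots i_n$ over $\mathcal D$ let $S_{\bf u}=S_{i_1}\circ\cdots\circ S_{i_n}$ (with $S_\emptyset=\mathrm{id}$), and call two words equivalent if they define the same map. Let $X$ be the set of equivalence classes of finite words and let the root $o$ be the class of the empty word. Two distinct vertices are joined by a vertical edge if they have representatives of the form ${\bf u}$ and ${\bf u}\ell$ with $\ell\in\mathcal D$, and by a horizontal edge if they have representatives ${\bf u},{\bf v}$ of the same length $n\ge1$ with $S_{\bf u}(J)\cap S_{\bf v}(J)\ne\emptyset$. Let $\mathcal E$ be the set of all these edges. *Hyperbolicity and boundary.* Let $d_X$ be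 the graph distance, $|x|=d_X(o,x)$, and $|x\wedge y|=\frac12(|x|+|y|-d_X(x,y))$. The number $\delta\ge0$ is a hyperbolicity constant if $|x\wedge y|\ge\min\{|x\wedge z|,|z\wedge y|\}-\delta$ for all $x,y,z\in X$; a connected graph with such a constant is called hyperbolic. For $a>0$ put $\rho_a(x,y)=e^{-a|x\wedge y|}$ if $x\ne y$ and $\rho_a(x,x)=0$. The hyperbolic boundary is $\partial X=\hat X\setminus X$, where the completion $\hat X$ consists of the $\rho_a$-Cauchy sequences in $X$ modulo the relation $\rho_a(x_n,y_n)\to0$. For $\xi\neq\eta$ in $\partial X$, $\rho_a(\xi,\eta)=e^{-a|\xi\wedge\eta|}$ with $|\xi\wedge\eta|=\sup\liminf_{m,n\to\infty}|x_m\wedge y_n|$, the supremum being over all Cauchy sequences $(x_m),(y_n)$ representing $\xi,\eta$. *The pseudo-norm.* Let $B_s$ be the open Euclidean ball of radius $s$ about $0$. Fix $0<r<\frac12$ and a $C^\infty$ function $\varphi\ge0$ that vanishes outside $B_r$, with $\varphi(-x)=\varphi(x)$, $\int\varphi=1$ and $0\in\operatorname{supp}\varphi$ (the closed support). Let $V=AB_1\setminus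 B_1$, $h=\chi_V*\varphi$, and $w(x)=\sum_{n\in\mathbb Z}q^{-n/d}h(A^nx)$. **Theorem.** The graph $(X,\mathcal E)$ is hyperbolic. Moreover, for every hyperbolicity constant $\delta$ of $(X,\mathcal E)$ and every $a>0$ with $e^{3\delta a}<\sqrt2$ there are a bijection $\phi:\partial X\to K$ and a constant $C>0$ such that $$C^{-1}w(\phi(\xi)-\phi(\eta))\le\rho_a(\xi,\eta)^\alpha\le C\,w(\phi(\xi)-\phi(\eta))\qquad\text{for all }\xi\ne\eta\in\partial X,$$ where $\alpha=\frac{\log q}{da}$. -/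

import Mathlib

open Filter Topology MeasureTheory
open scoped ContDiff

noncomputable section

/-! ### Gromov hyperbolic graphs and the hyperbolic boundary -/

namespace HypGraph

variable {V : Type*}

/-- The Gromov product `|x ∧ y| = (|x| + |y| - d(x, y)) / 2` with reference point `o`. -/
def gromovProduct (G : SimpleGraph V) (o x y : V) : ℝ :=
  ((G.dist o x : ℝ) + (G.dist o y : ℝ) - (G.dist x y : ℝ)) / 2

/-- `δ` is a hyperbolicity constant of `G` with respect to `o`. -/
def HyperbolicWith (G : SimpleGraph V) (o : V) (δ : ℝ) : Prop :=
  0 ≤ δ ∧ ∀ x y z : V,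
    min (gromovProduct G o x z) (gromovProduct G o z y) - δ ≤ gromovProduct G o x y

/-- A graph is hyperbolic if it is connected and has some hyperbolicity constant. -/
def Hyperbolic (G : SimpleGraph V) (o : V) : Prop :=
  G.Connected ∧ ∃ δ : ℝ, HyperbolicWith G o δ

open Classical in
/-- `ρ_a(x, y) = exp (-a |x ∧ y|)` for `x ≠ y`, and `ρ_a(x, x) = 0`. -/
def visual (G : SimpleGraph V) (o : V) (a : ℝ) (x y : V) : ℝ :=
  if x = y then 0 else Real.exp (-a * gromovProduct G o x y)

theorem visual_self (G : SimpleGraph V) (o : V) (a : ℝ) (x : V) : visual G o a x x = 0 := by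
  simp [visual]

theorem visual_nonneg (G : SimpleGraph V) (o : V) (a : ℝ) (x y : V) : 0 ≤ visual G o a x y := by
  unfold visual; split_ifs <;> positivity

theorem visual_comm (G : SimpleGraph V) (o : V) (a : ℝ) (x y : V) :
    visual G o a x y = visual G o a y x := by
  have h : gromovProduct G o x y = gromovProduct G o y x := by
    unfold gromovProduct; rw [G.dist_comm (u := x) (v := y)]; ring
  by_cases hxy : x = y
  · rw [hxy]
  · simp only [visual, hxy, Ne.symm hxy, if_false, h]

theorem visual_le {G : SimpleGraph V} {o : V} {a δ : ℝ} (ha : 0 < a)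
    (h : HyperbolicWith G o δ) (x y z : V) :
    visual G o a x y ≤ Real.exp (a * δ) * (visual G o a x z + visual G o a z y) := by
  have h1 : 1 ≤ Real.exp (a * δ) := Real.one_le_exp (mul_nonneg ha.le h.1)
  have hn := visual_nonneg G o a
  by_cases hxz : x = z
  · subst hxz
    rw [visual_self, zero_add]
    exact le_mul_of_one_le_left (hn _ _) h1
  by_cases hzy : z = y
  · subst hzy
    rw [visual_self, add_zero]
    exact le_mul_of_one_le_left (hn _ _) h1
  by_cases hxy : x = y
  · subst hxy
    rw [visual_self]
    exact mul_nonneg (by positivity) (add_nonneg (hn _ _) (hn _ _))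
  simp only [visual, hxz, hzy, hxy, if_false]
  rw [mul_add, ← Real.exp_add, ← Real.exp_add]
  have h2 := h.2 x y z
  rcases le_total (gromovProduct G o x z) (gromovProduct G o z y) with h3 | h3
  · rw [min_eq_left h3] at h2
    refine le_add_of_le_of_nonneg (Real.exp_le_exp.2 ?_) (Real.exp_pos _).le
    nlinarith
  · rw [min_eq_right h3] at h2
    refine le_add_of_nonneg_of_le (Real.exp_pos _).le (Real.exp_le_exp.2 ?_)
    nlinarith

/-- The `ρ_a`-Cauchy sequences of vertices. -/
def CauchySeqs (G : SimpleGraph V) (o : V) (a : ℝ) : Type _ :=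
  {x : ℕ → V // Tendsto (fun p : ℕ × ℕ => visual G o a (x p.1) (x p.2)) atTop (𝓝 0)}

/-- Two `ρ_a`-Cauchy sequences are equivalent if `ρ_a(x_n, y_n) → 0`. -/
def cauchySetoid {G : SimpleGraph V} {o : V} (hG : Hyperbolic G o) {a : ℝ} (ha : 0 < a) :
    Setoid (CauchySeqs G o a) where
  r x y := Tendsto (fun n : ℕ => visual G o a (x.1 n) (y.1 n)) atTop (𝓝 0)
  iseqv :=
    { refl := fun x => by simp only [visual_self]; exact tendsto_const_nhds
      symm := fun {x y} h => by simpa only [visual_comm G o a] using h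
      trans := fun {x y z} hxy hyz => by
        obtain ⟨-, δ, hδ⟩ := hG
        refine squeeze_zero (fun n => visual_nonneg G o a _ _)
          (fun n => visual_le ha hδ (x.1 n) (z.1 n) (y.1 n)) ?_
        simpa using (hxy.add hyz).const_mul (Real.exp (a * δ)) }

/-- The `ρ_a`-completion of the vertex set of a hyperbolic graph. -/
def Completion {G : SimpleGraph V} {o : V} (hG : Hyperbolic G o) {a : ℝ} (ha : 0 < a) : Type _ :=
  Quotient (cauchySetoid hG ha)

/-- The point of the completion represented by a Cauchy sequence. -/
def Completion.mk {G : SimpleGraph V} {o : V} (hG : Hyperbolic G o) {a : ℝ} (ha : 0 < a)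
    (x : CauchySeqs G o a) : Completion hG ha :=
  Quotient.mk (cauchySetoid hG ha) x

/-- The canonical map of the vertex set into its completion (constant sequences). -/
def Completion.ofVertex {G : SimpleGraph V} {o : V} (hG : Hyperbolic G o) {a : ℝ} (ha : 0 < a)
    (v : V) : Completion hG ha :=
  Completion.mk hG ha
    ⟨fun _ => v, by simp only [visual_self]; exact tendsto_const_nhds⟩

/-- The hyperbolic boundary: the completion minus the vertex set. -/
def Boundary {G : SimpleGraph V} {o : V} (hG : Hyperbolic G o) {a : ℝ} (ha : 0 < a) : Type _ :=
  {ξ : Completion hG ha // ξ ∉ Set.range (Completion.ofVertex hG ha)}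

/-- The extension of `ρ_a` to the completion: the infimum of `limsup ρ_a(x_m, y_n)` as
`m, n → ∞`, over all Cauchy sequences `x`, `y` that represent `ξ`, `η`. For distinct boundary
points it is `exp (-a |ξ ∧ η|)` with the usual extension
`|ξ ∧ η| = sup liminf |x_m ∧ y_n|` of the Gromov product. -/
def visualExt {G : SimpleGraph V} {o : V} (hG : Hyperbolic G o) {a : ℝ} (ha : 0 < a)
    (ξ η : Completion hG ha) : ℝ :=
  ⨅ p : {p : CauchySeqs G o a × CauchySeqs G o a //
      Completion.mk hG ha p.1 = ξ ∧ Completion.mk hG ha p.2 = η},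
    limsup (fun mn : ℕ × ℕ => visual G o a (p.1.1.1 mn.1) (p.1.2.1 mn.2)) atTop

end HypGraph

/-! ### Integral self-affine sets, the symbolic graph and the pseudo-norm -/

namespace SelfAffine

variable {d : ℕ}

/-- The matrix `A` with real entries. -/
abbrev realMat (A : Matrix (Fin d) (Fin d) ℤ) : Matrix (Fin d) (Fin d) ℝ :=
  A.map (Int.cast : ℤ → ℝ)

/-- All complex eigenvalues have modulus larger than one. -/
def Expanding (A : Matrix (Fin d) (Fin d) ℤ) : Prop :=
  ∀ μ ∈ spectrum ℂ (A.map (Int.cast : ℤ → ℂ)), 1 < ‖μ‖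

/-- An integer vector as a point of Euclidean space. -/
def intVec (t : Fin d → ℤ) : EuclideanSpace ℝ (Fin d) :=
  WithLp.toLp 2 (fun i => (t i : ℝ))

/-- The map `x ↦ A⁻¹ (x + t)`. -/
def affMap (A : Matrix (Fin d) (Fin d) ℤ) (t : Fin d → ℤ) (x : EuclideanSpace ℝ (Fin d)) :
    EuclideanSpace ℝ (Fin d) :=
  Matrix.toEuclideanLin (realMat A)⁻¹ (x + intVec t)

/-- `K` is the self-affine set `K = A⁻¹ (K + D)`: the nonempty compact set with
`K = ⋃_{t ∈ D} S_t(K)`. -/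
def IsSelfAffineSet (A : Matrix (Fin d) (Fin d) ℤ) (D : Finset (Fin d → ℤ))
    (K : Set (EuclideanSpace ℝ (Fin d))) : Prop :=
  K.Nonempty ∧ IsCompact K ∧ K = ⋃ t ∈ D, affMap A t '' K

/-- `J` is a nonempty bounded closed set with `S_t(J) ⊆ J` for all `t ∈ D`. -/
def IsInvariantSet (A : Matrix (Fin d) (Fin d) ℤ) (D : Finset (Fin d → ℤ))
    (J : Set (EuclideanSpace ℝ (Fin d))) : Prop :=
  J.Nonempty ∧ Bornology.IsBounded J ∧ IsClosed J ∧ ∀ t ∈ D, affMap A t '' J ⊆ J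

/-- `S_u = S_{i_1} ∘ ⋯ ∘ S_{i_n}` for a word `u = i_1 ⋯ i_n` over the digit set. -/
def wordMap (A : Matrix (Fin d) (Fin d) ℤ) (D : Finset (Fin d → ℤ)) :
    List D → EuclideanSpace ℝ (Fin d) → EuclideanSpace ℝ (Fin d)
  | [] => id
  | i :: u => affMap A i.1 ∘ wordMap A D u

/-- Two words are equivalent if they define the same map. -/
def wordSetoid (A : Matrix (Fin d) (Fin d) ℤ) (D : Finset (Fin d → ℤ)) : Setoid (List D) :=
  Setoid.ker (wordMap A D)

/-- The vertex set: the finite words modulo equivalence. -/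
def Vertex (A : Matrix (Fin d) (Fin d) ℤ) (D : Finset (Fin d → ℤ)) : Type :=
  Quotient (wordSetoid A D)

/-- The class of a word. -/
def Vertex.mk (A : Matrix (Fin d) (Fin d) ℤ) (D : Finset (Fin d → ℤ)) (u : List D) :
    Vertex A D :=
  Quotient.mk (wordSetoid A D) u

/-- The root: the class of the empty word. -/
def root (A : Matrix (Fin d) (Fin d) ℤ) (D : Finset (Fin d → ℤ)) : Vertex A D :=
  Vertex.mk A D []

/-- `y` is represented by a one-letter extension of a representative of `x`. -/
def IsChild (A : Matrix (Fin d) (Fin d) ℤ) (D : Finset (Fin d → ℤ)) (x y : Vertex A D) : Prop :=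
  ∃ (u : List D) (l : D), Vertex.mk A D u = x ∧ Vertex.mk A D (u ++ [l]) = y

/-- `x` and `y` lie on one level `n ≥ 1` and their cells `S_u(J)`, `S_v(J)` meet. -/
def CellsMeet (A : Matrix (Fin d) (Fin d) ℤ) (D : Finset (Fin d → ℤ))
    (J : Set (EuclideanSpace ℝ (Fin d))) (x y : Vertex A D) : Prop :=
  ∃ u v : List D, 1 ≤ u.length ∧ u.length = v.length ∧
    Vertex.mk A D u = x ∧ Vertex.mk A D v = y ∧
    (wordMap A D u '' J ∩ wordMap A D v '' J).Nonempty

/-- The graph `(X, E)` with vertical and horizontal edges. -/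
def symbolicGraph (A : Matrix (Fin d) (Fin d) ℤ) (D : Finset (Fin d → ℤ))
    (J : Set (EuclideanSpace ℝ (Fin d))) : SimpleGraph (Vertex A D) where
  Adj x y := x ≠ y ∧ ((IsChild A D x y ∨ IsChild A D y x) ∨ CellsMeet A D J x y)
  symm := ⟨by
    rintro x y ⟨hne, hv | ⟨u, v, hu, huv, rfl, rfl, hm⟩⟩
    · exact ⟨hne.symm, Or.inl hv.symm⟩
    · exact ⟨hne.symm, Or.inr ⟨v, u, huv ▸ hu, huv.symm, rfl, rfl, by rwa [Set.inter_comm]⟩⟩⟩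
  loopless := ⟨fun _ h => h.1 rfl⟩

/-- An even smooth density `φ ≥ 0` supported in the open ball of radius `r < 1/2` about `0`,
with `∫ φ = 1`, whose (closed) support contains the centre `0`. -/
structure IsBump (r : ℝ) (φ : EuclideanSpace ℝ (Fin d) → ℝ) : Prop where
  radius_pos : 0 < r
  radius_lt : r < 1 / 2
  smooth : ContDiff ℝ ∞ φ
  nonneg : ∀ x, 0 ≤ φ x
  support_subset : Function.support φ ⊆ Metric.ball 0 r
  even : ∀ x, φ (-x) = φ x
  integral_eq_one : ∫ x, φ x = 1
  zero_mem : (0 : EuclideanSpace ℝ (Fin d)) ∈ tsupport φ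

/-- `V = A B_1 \ B_1`, with `B_1` the open Euclidean unit ball. -/
def annulus (A : Matrix (Fin d) (Fin d) ℤ) : Set (EuclideanSpace ℝ (Fin d)) :=
  (Matrix.toEuclideanLin (realMat A) '' Metric.ball 0 1) \ Metric.ball 0 1

/-- `h = χ_V ∗ φ`. -/
def smoothedAnnulus (A : Matrix (Fin d) (Fin d) ℤ) (φ : EuclideanSpace ℝ (Fin d) → ℝ) :
    EuclideanSpace ℝ (Fin d) → ℝ :=
  MeasureTheory.convolution ((annulus A).indicator (fun _ => (1 : ℝ))) φ
    (ContinuousLinearMap.mul ℝ ℝ) volume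

/-- The pseudo-norm `w(x) = ∑_{n ∈ ℤ} q^{-n/d} h(Aⁿ x)`, where `q = |det A|`. -/
def pseudoNorm (A : Matrix (Fin d) (Fin d) ℤ) (φ : EuclideanSpace ℝ (Fin d) → ℝ)
    (x : EuclideanSpace ℝ (Fin d)) : ℝ :=
  ∑' n : ℤ, |(A.det : ℝ)| ^ (-(n : ℝ) / (d : ℝ)) *
    smoothedAnnulus A φ (Matrix.toEuclideanLin (realMat A ^ n) x)

end SelfAffine

end

/-! ### Expanding groups of linear maps and the scale of a vector. -/

noncomputable section

/-! Fix a point κ of K; since K ⊆ J, also κ ∈ J. Code a vertex x by P(x) = S_x(κ) ∈ K. Everything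
rests on one comparison (`IsCoding`): up to a bounded error, |x ∧ y| is the largest k, at most the
levels of x and y, for which A^k (P x - P y) stays bounded.

For `upper`, follow a geodesic from x to y. A step at level l moves P by A^(-l) applied to a bounded
vector, and the levels exceed |x ∧ y| at least by the distance to the middle of the path, so a
two-sided geometric series bounds A^k (P x - P y) for k ≤ |x ∧ y|. For `lower`, the level-k cells
are A^(-k) applied to integral translates of the compact set J. Finitely many relative positions
matter, so translates that are close enough must meet. Hence the level-k ancestors of x and y are
equal or adjacent, and |x ∧ y| ≥ k - 1/2.

Hyperbolicity is then the triangle inequality for P, with the factor 2 absorbed by finitely many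
contractions. For sequences leaving every ball, ρ_a → 0 means exactly that the differences of the
codes tend to 0, so limits of codes identify ∂X with K. If v = φ(ξ) - φ(η) has scale k, meaning that
A^k v is the first iterate outside the unit ball for good (`exists_scale`), then |ξ ∧ η| = k + O(1)
and ρ_a(ξ, η) ≍ e^(-ak).

The pseudo-norm satisfies w(Ax) = q^(1/d) w(x) and is continuous and positive on a compact shell, so
w(v) ≍ q^(-k/d). The exponent α is the one with (e^(-ak))^α = q^(-k/d). -/

/-- A one-parameter group `(L n)`, `n ∈ ℤ`, of linear maps whose negative powers contract
exponentially. -/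
structure ExpandingGroup {E : Type*} [NormedAddCommGroup E] [NormedSpace ℝ E]
    (L : ℤ → E →L[ℝ] E) : Prop where
  zero : L 0 = ContinuousLinearMap.id ℝ E
  add : ∀ m n x, L (m + n) x = L m (L n x)
  decay : ∃ C : ℝ, ∃ lam : ℝ, 0 < C ∧ 0 < lam ∧ lam < 1 ∧
    ∀ (n : ℕ) (x : E), ‖L (-n) x‖ ≤ C * lam ^ n * ‖x‖

namespace ExpandingGroup

variable {E : Type*} [NormedAddCommGroup E] [NormedSpace ℝ E] {L : ℤ → E →L[ℝ] E}

theorem zero_apply (hL : ExpandingGroup L) (x : E) : L 0 x = x := by simp [hL.zero]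

theorem neg_self (hL : ExpandingGroup L) (n : ℤ) (x : E) : L (-n) (L n x) = x := by
  rw [← hL.add, neg_add_cancel, hL.zero_apply]

theorem self_neg (hL : ExpandingGroup L) (n : ℤ) (x : E) : L n (L (-n) x) = x := by
  rw [← hL.add, add_neg_cancel, hL.zero_apply]

theorem exists_nat (hL : ExpandingGroup L) (B : ℝ) {ε : ℝ} (hε : 0 < ε) :
    ∃ N : ℕ, ∀ n : ℤ, N ≤ n → ∀ x : E, ‖x‖ ≤ B → ‖L (-n) x‖ < ε := by
  obtain ⟨C, lam, hC, h0, h1, h⟩ := hL.decay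
  have ht : Tendsto (fun n : ℕ => C * lam ^ n * B) atTop (𝓝 0) := by
    simpa using ((tendsto_pow_atTop_nhds_zero_of_lt_one h0.le h1).const_mul C).mul_const B
  obtain ⟨N, hN⟩ := eventually_atTop.1 (ht.eventually_lt_const hε)
  refine ⟨N, fun n hn x hx => ?_⟩
  lift n to ℕ using by omega
  refine ((h n x).trans ?_).trans_lt (hN n (by exact_mod_cast hn))
  gcongr

/-- If `L m x` is not small and `L n x` is bounded then `n` is not much larger than `m`. -/
theorem exists_nat_lt (hL : ExpandingGroup L) (B : ℝ) {ε : ℝ} (hε : 0 < ε) :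
    ∃ N : ℕ, ∀ (m n : ℤ) (x : E), ε ≤ ‖L m x‖ → ‖L n x‖ ≤ B → n < m + N := by
  obtain ⟨N, hN⟩ := hL.exists_nat B hε
  refine ⟨N, fun m n x hm hn => ?_⟩
  by_contra! hlt
  have h := hN (n - m) (by omega) _ hn
  rw [← hL.add, show -(n - m) + n = m by ring] at h
  exact absurd h hm.not_gt

/-- Every nonzero vector has a translate in a fixed annulus, entered from the unit ball. -/
theorem exists_scale (hL : ExpandingGroup L) {x : E} (hx : x ≠ 0) :
    ∃ k : ℤ, ‖L (k - 1) x‖ < 1 ∧ 1 ≤ ‖L k x‖ := by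
  obtain ⟨N, hN⟩ := hL.exists_nat ‖x‖ one_pos
  obtain ⟨M, hM⟩ := hL.exists_nat_lt 1 (norm_pos_iff.2 hx)
  -- The set of n with ‖L n x‖ < 1 is bounded above and nonempty; its greatest element is k - 1.
  have hM' : ∀ n : ℤ, ‖L n x‖ < 1 → n < M := fun n hn => by
    simpa using hM 0 n x (by rw [hL.zero_apply]) hn.le
  obtain ⟨k, hk, hmax⟩ := Int.exists_greatest_of_bdd (P := fun n => ‖L n x‖ < 1)
    ⟨M, fun n hn => (hM' n hn).le⟩ ⟨-N, hN N le_rfl x le_rfl⟩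
  refine ⟨k + 1, by simpa using hk, ?_⟩
  by_contra! h
  have := hmax _ h
  omega

end ExpandingGroup

/-! ### Powers of an expanding integer matrix. -/

namespace SelfAffine

variable {d : ℕ}

/-- The powers of `A` as continuous linear maps. -/
def powMap (A : Matrix (Fin d) (Fin d) ℤ) (n : ℤ) :
    EuclideanSpace ℝ (Fin d) →L[ℝ] EuclideanSpace ℝ (Fin d) :=
  Matrix.toEuclideanCLM (n := Fin d) (𝕜 := ℝ) (realMat A ^ n)

theorem powMap_apply (A : Matrix (Fin d) (Fin d) ℤ) (n : ℤ) (x : EuclideanSpace ℝ (Fin d)) :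
    powMap A n x = Matrix.toEuclideanLin (realMat A ^ n) x := rfl

theorem Expanding.det_ne_zero {A : Matrix (Fin d) (Fin d) ℤ} (hA : Expanding A) : A.det ≠ 0 := by
  intro h
  have h0 : (0 : ℂ) ∈ spectrum ℂ (A.map (Int.cast : ℤ → ℂ)) := by
    rw [spectrum.zero_mem_iff, Matrix.isUnit_iff_isUnit_det]
    have : (A.map (Int.cast : ℤ → ℂ)).det = ((A.det : ℤ) : ℂ) :=
      ((Int.castRingHom ℂ).map_det A).symm
    rw [this, h]
    simp
  have := hA 0 h0
  simp at this
  linarith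

theorem det_realMat (A : Matrix (Fin d) (Fin d) ℤ) : (realMat A).det = A.det :=
  ((Int.castRingHom ℝ).map_det A).symm

theorem Expanding.isUnit_det {A : Matrix (Fin d) (Fin d) ℤ} (hA : Expanding A) :
    IsUnit (realMat A).det := by
  rw [det_realMat, isUnit_iff_ne_zero]
  exact_mod_cast hA.det_ne_zero

/-- Transfers the decay estimate, obtained from complex eigenvalues, back to the real matrix. -/
theorem norm_toEuclideanLin_complexify (M : Matrix (Fin d) (Fin d) ℝ)
    (x : EuclideanSpace ℝ (Fin d)) :
    ‖Matrix.toEuclideanLin M x‖ = ‖Matrix.toEuclideanLin (M.map (Complex.ofReal))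
      (WithLp.toLp 2 (fun i => (x i : ℂ)))‖ := by
  rw [EuclideanSpace.norm_eq, EuclideanSpace.norm_eq]
  congr 1
  refine Finset.sum_congr rfl fun i _ => ?_
  have := RingHom.map_mulVec Complex.ofRealHom M x.ofLp i
  simp only [Matrix.toLpLin_apply]
  have h2 : (M.map Complex.ofReal).mulVec (fun i => (x i : ℂ)) i = (M.mulVec x.ofLp i : ℝ) :=
    this.symm
  rw [h2, Complex.norm_real]

-- Gelfand's formula gives ‖B^n‖ ≤ lam^n for large n, for any lam strictly between the spectral
-- radius and 1. The finitely many remaining powers only affect the constant.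
open scoped Matrix.Norms.L2Operator in
theorem exists_pow_norm_le_of_spectrum (B : Matrix (Fin d) (Fin d) ℂ)
    (hB : ∀ z ∈ spectrum ℂ B, ‖z‖ < 1) :
    ∃ C : ℝ, ∃ lam : ℝ, 0 < C ∧ 0 < lam ∧ lam < 1 ∧
      ∀ (n : ℕ) (x : EuclideanSpace ℂ (Fin d)),
        ‖Matrix.toEuclideanLin (B ^ n) x‖ ≤ C * lam ^ n * ‖x‖ := by
  have hlt : spectralRadius ℂ B < 1 := by
    rcases (spectrum ℂ B).eq_empty_or_nonempty with he | hne
    · simp [spectralRadius, he]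
    · exact_mod_cast spectrum.spectralRadius_lt_of_forall_lt_of_nonempty hne (r := 1)
        (fun z hz => by exact_mod_cast hB z hz)
  obtain ⟨lam, hl1, hl2⟩ := ENNReal.lt_iff_exists_nnreal_btwn.1 hlt
  have hl0 : 0 < lam := by
    have : (0 : ENNReal) < lam := hl1.pos
    exact_mod_cast this
  have hl3 : lam < 1 := by exact_mod_cast hl2
  have hev := (spectrum.pow_nnnorm_pow_one_div_tendsto_nhds_spectralRadius B).eventually_lt_const hl1
  obtain ⟨N, hN⟩ := eventually_atTop.1 hev
  have hb : ∀ n : ℕ, N + 1 ≤ n → ‖B ^ n‖ ≤ (lam : ℝ) ^ n := by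
    intro n hn
    have h1 := hN n (by omega)
    have hn0 : (n : ℝ) ≠ 0 := by
      have : n ≠ 0 := by omega
      exact_mod_cast this
    have h2 : ((‖B ^ n‖₊ : ENNReal) ^ (1 / n : ℝ)) ^ (n : ℝ) ≤ (lam : ENNReal) ^ (n : ℝ) :=
      ENNReal.rpow_le_rpow h1.le (by positivity)
    rw [← ENNReal.rpow_mul, one_div_mul_cancel hn0, ENNReal.rpow_one, ENNReal.rpow_natCast] at h2
    exact_mod_cast h2
  have hpos : (0 : ℝ) < lam := hl0
  set S : ℝ := ∑ j ∈ Finset.range (N + 1), ‖B ^ j‖ / (lam : ℝ) ^ j with hS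
  have hS0 : 0 ≤ S := Finset.sum_nonneg fun j _ => by positivity
  refine ⟨S + 1, lam, by positivity, hpos, by exact_mod_cast hl3, fun n x => ?_⟩
  refine (Matrix.l2_opNorm_mulVec (B ^ n) x).trans ?_
  gcongr
  rcases le_or_gt (N + 1) n with h | h
  · refine (hb n h).trans (le_mul_of_one_le_left (by positivity) (by linarith))
  · have : ‖B ^ n‖ / (lam : ℝ) ^ n ≤ S :=
      Finset.single_le_sum (f := fun j => ‖B ^ j‖ / (lam : ℝ) ^ j)
        (fun j _ => by positivity) (Finset.mem_range.2 h)
    rw [div_le_iff₀ (by positivity)] at this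
    refine this.trans ?_
    gcongr
    linarith

theorem Expanding.expandingGroup {A : Matrix (Fin d) (Fin d) ℤ} (hA : Expanding A) :
    ExpandingGroup (powMap A) where
  zero := by
    ext x i
    simp [powMap]
  add m n x := by
    simp [powMap, Matrix.zpow_add hA.isUnit_det]
  decay := by
    set Ac : Matrix (Fin d) (Fin d) ℂ := A.map (Int.cast : ℤ → ℂ) with hAc
    have hu : IsUnit Ac := by
      by_contra h
      have := hA 0 (by rwa [spectrum.zero_mem_iff])
      simp at this
      linarith
    obtain ⟨U, hU⟩ := hu
    have hinv : Ac⁻¹ = (↑U⁻¹ : Matrix (Fin d) (Fin d) ℂ) := by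
      rw [← hU, Matrix.coe_units_inv]
    have hsp : ∀ z ∈ spectrum ℂ Ac⁻¹, ‖z‖ < 1 := by
      intro z hz
      rw [hinv, ← spectrum.map_inv, Set.mem_inv, hU] at hz
      have h1 := hA _ hz
      rw [norm_inv] at h1
      exact (one_lt_inv_iff₀.1 h1).2
    obtain ⟨C, lam, hC, h0, h1, h⟩ := exists_pow_norm_le_of_spectrum _ hsp
    refine ⟨C, lam, hC, h0, h1, fun n x => ?_⟩
    have hmap : ((realMat A) ^ (-(n : ℤ))).map Complex.ofReal = Ac⁻¹ ^ n := by
      have e1 : Ac = (realMat A).map Complex.ofReal := by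
        ext i j; simp [hAc]
      have e2 : Ac⁻¹ = ((realMat A)⁻¹).map Complex.ofReal := by
        rw [e1]
        refine Matrix.inv_eq_right_inv ?_
        have := congrArg (Complex.ofRealHom.mapMatrix) (Matrix.mul_nonsing_inv _ hA.isUnit_det)
        rw [map_mul, map_one] at this
        exact this
      rw [e2, Matrix.zpow_neg_natCast, ← Matrix.inv_pow']
      exact map_pow Complex.ofRealHom.mapMatrix _ n
    have hx : ‖(WithLp.toLp 2 (fun i => (x i : ℂ)) : EuclideanSpace ℂ (Fin d))‖ = ‖x‖ := by
      simp [EuclideanSpace.norm_eq]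
    rw [powMap_apply, norm_toEuclideanLin_complexify, hmap, ← hx]
    exact h n _

end SelfAffine

/-! ### Words, vertices, levels and the distance to the root. -/

namespace SelfAffine

variable {d : ℕ} {A : Matrix (Fin d) (Fin d) ℤ} {D : Finset (Fin d → ℤ)}
  {J K : Set (EuclideanSpace ℝ (Fin d))}

theorem affMap_eq (A : Matrix (Fin d) (Fin d) ℤ) (t : Fin d → ℤ) (x : EuclideanSpace ℝ (Fin d)) :
    affMap A t x = powMap A (-1) (x + intVec t) := by
  rw [affMap, powMap_apply, Matrix.zpow_neg_one]

theorem intVec_add (s t : Fin d → ℤ) : intVec (s + t) = intVec s + intVec t := by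
  ext i; simp [intVec]

theorem intVec_sub (s t : Fin d → ℤ) : intVec (s - t) = intVec s - intVec t := by
  ext i; simp [intVec]

theorem powMap_intVec (A : Matrix (Fin d) (Fin d) ℤ) (n : ℕ) (t : Fin d → ℤ) :
    powMap A n (intVec t) = intVec ((A ^ n).mulVec t) := by
  have h : realMat A ^ n = (A ^ n).map (Int.cast : ℤ → ℝ) :=
    (map_pow (Int.castRingHom ℝ).mapMatrix A n).symm
  ext i
  have := RingHom.map_mulVec (Int.castRingHom ℝ) (A ^ n) t i
  rw [powMap_apply, zpow_natCast, h]
  simp only [Matrix.toLpLin_apply]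
  exact this.symm

/-- A digit pulled through A^|u| remains an integer vector. This integrality makes cells of one
level rescaled integral translates of each other. -/
theorem exists_wordMap_eq (hA : Expanding A) (u : List D) :
    ∃ t : Fin d → ℤ, ∀ x, wordMap A D u x = powMap A (-(u.length : ℤ)) (x + intVec t) := by
  have hL := hA.expandingGroup
  induction u with
  | nil => exact ⟨0, fun x => by simp [wordMap, hL.zero_apply, intVec]; rfl⟩
  | cons i u ih =>
    obtain ⟨t, ht⟩ := ih
    refine ⟨t + (A ^ u.length).mulVec i.1, fun x => ?_⟩
    rw [wordMap, Function.comp_apply, ht, affMap_eq, intVec_add, ← powMap_intVec, ← add_assoc]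
    have : powMap A (-((i :: u).length : ℤ)) = powMap A (-1 + -(u.length : ℤ)) := by
      congr 1; simp
    rw [this, hL.add, (powMap A (-(u.length : ℤ))).map_add (x + intVec t), hL.neg_self]

theorem wordMap_append (u v : List D) (x : EuclideanSpace ℝ (Fin d)) :
    wordMap A D (u ++ v) x = wordMap A D u (wordMap A D v x) := by
  induction u with
  | nil => rfl
  | cons i u ih => simp [wordMap, ih]

theorem wordMap_image_subset (hJ : ∀ t ∈ D, affMap A t '' J ⊆ J) (u : List D) :
    wordMap A D u '' J ⊆ J := by
  induction u with
  | nil => simp [wordMap]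
  | cons i u ih =>
    rw [wordMap, Set.image_comp]
    exact (Set.image_mono ih).trans (hJ i.1 i.2)

/-- If the lengths differed by m > 0, comparing linear parts would give A^(-m) = id, contradicting
the contraction of negative powers on a nonzero vector. The lemma makes levels well defined. -/
theorem length_eq_of_wordMap_eq (hd : 0 < d) (hA : Expanding A) {u v : List D}
    (h : wordMap A D u = wordMap A D v) : u.length = v.length := by
  have hL := hA.expandingGroup
  have key : ∀ u v : List D, wordMap A D u = wordMap A D v → ¬ u.length < v.length := by
    intro u v h hlt
    obtain ⟨s, hs⟩ := exists_wordMap_eq hA u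
    obtain ⟨t, ht⟩ := exists_wordMap_eq hA v
    have e : ∀ x, powMap A (-(u.length : ℤ)) x = powMap A (-(v.length : ℤ)) x := by
      intro x
      -- Subtracting the value at 0 isolates the linear part.
      have h1 := congrFun h x
      have h0 := congrFun h 0
      rw [hs, ht] at h1 h0
      simp only [map_add, zero_add] at h1 h0
      rw [h0] at h1
      exact add_right_cancel h1
    set m : ℕ := v.length - u.length with hm
    have e2 : ∀ x, powMap A (-(m : ℤ)) x = x := by
      intro x
      have := e (powMap A u.length x)
      rw [hL.neg_self, ← hL.add] at this
      rw [show (-(m : ℤ)) = -(v.length : ℤ) + u.length by omega]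
      exact this.symm
    have e3 : ∀ (j : ℕ) x, powMap A (-(j * m : ℤ)) x = x := by
      intro j
      induction j with
      | zero => intro x; simp [hL.zero_apply]
      | succ j ih =>
        intro x
        rw [show (-(((j + 1 : ℕ) : ℤ) * m) : ℤ) = -(j * m) + -(m : ℤ) by push_cast; ring, hL.add, e2,
          ih]
    have : Nonempty (Fin d) := ⟨⟨0, hd⟩⟩
    obtain ⟨x, hx⟩ := exists_ne (0 : EuclideanSpace ℝ (Fin d))
    obtain ⟨N, hN⟩ := hL.exists_nat ‖x‖ (norm_pos_iff.2 hx)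
    have hm1 : 1 ≤ m := by omega
    have := hN (N * m) (by exact_mod_cast Nat.le_mul_of_pos_right N hm1) x le_rfl
    rw [e3] at this
    exact lt_irrefl _ this
  exact le_antisymm (not_lt.1 (key v u h.symm)) (not_lt.1 (key u v h))

/-- The map `S_u` attached to a vertex. -/
def Vertex.map (x : Vertex A D) : EuclideanSpace ℝ (Fin d) → EuclideanSpace ℝ (Fin d) :=
  Quotient.lift (s := wordSetoid A D) (wordMap A D) (fun _ _ h => h) x

@[simp]
theorem Vertex.map_mk (u : List D) : (Vertex.mk A D u).map = wordMap A D u := rfl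

theorem Vertex.mk_surjective (x : Vertex A D) : ∃ u, Vertex.mk A D u = x :=
  Quotient.exists_rep x

/-- The common length of the words representing a vertex. -/
def Vertex.level (x : Vertex A D) : ℕ := (Quotient.out (s := wordSetoid A D) x).length

theorem Vertex.level_mk (hd : 0 < d) (hA : Expanding A) (u : List D) :
    (Vertex.mk A D u).level = u.length :=
  length_eq_of_wordMap_eq hd hA (Quotient.mk_out (s := wordSetoid A D) u)

theorem exists_map_eq (hd : 0 < d) (hA : Expanding A) (x : Vertex A D) :
    ∃ t : Fin d → ℤ, ∀ y, x.map y = powMap A (-(x.level : ℤ)) (y + intVec t) := by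
  obtain ⟨u, rfl⟩ := x.mk_surjective
  rw [Vertex.level_mk hd hA]
  exact exists_wordMap_eq hA u

theorem powMap_map_sub (hd : 0 < d) (hA : Expanding A) (x : Vertex A D)
    (y z : EuclideanSpace ℝ (Fin d)) :
    powMap A x.level (x.map y - x.map z) = y - z := by
  obtain ⟨t, ht⟩ := exists_map_eq hd hA x
  rw [ht, ht, ← map_sub, hA.expandingGroup.self_neg]
  abel

theorem level_of_isChild (hd : 0 < d) (hA : Expanding A) {x y : Vertex A D}
    (h : IsChild A D x y) : y.level = x.level + 1 := by
  obtain ⟨u, l, rfl, rfl⟩ := h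
  simp [Vertex.level_mk hd hA]

theorem level_of_cellsMeet (hd : 0 < d) (hA : Expanding A) {x y : Vertex A D}
    (h : CellsMeet A D J x y) : x.level = y.level := by
  obtain ⟨u, v, -, h, rfl, rfl, -⟩ := h
  simp [Vertex.level_mk hd hA, h]

/-- Adjacent vertices lie on neighbouring levels. -/
theorem level_le_of_adj (hd : 0 < d) (hA : Expanding A) {x y : Vertex A D}
    (h : (symbolicGraph A D J).Adj x y) : y.level ≤ x.level + 1 := by
  rcases h.2 with (h | h) | h
  · exact (level_of_isChild hd hA h).le
  · have := level_of_isChild hd hA h; omega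
  · have := level_of_cellsMeet hd hA h; omega

/-- A vertex has ancestors on all lower levels. -/
theorem exists_ancestor (hd : 0 < d) (hA : Expanding A) (hJ : ∀ t ∈ D, affMap A t '' J ⊆ J)
    (x : Vertex A D) {k : ℕ} (hk : k ≤ x.level) :
    ∃ z : Vertex A D, z.level = k ∧ x.map '' J ⊆ z.map '' J ∧
      ∃ p : (symbolicGraph A D J).Walk z x, p.length + k = x.level := by
  obtain ⟨u, rfl⟩ := x.mk_surjective
  rw [Vertex.level_mk hd hA] at hk ⊢
  induction u using List.reverseRecOn with
  | nil =>
    obtain rfl : k = 0 := by simpa using hk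
    exact ⟨_, by rw [Vertex.level_mk hd hA]; rfl, subset_rfl, SimpleGraph.Walk.nil, rfl⟩
  | append_singleton u l ih =>
    rcases hk.lt_or_eq with hlt | rfl
    · rw [List.length_append, List.length_singleton] at hlt
      obtain ⟨z, hz, hsub, p, hp⟩ := ih (by omega)
      have hadj : (symbolicGraph A D J).Adj (Vertex.mk A D u) (Vertex.mk A D (u ++ [l])) := by
        refine ⟨fun h => ?_, Or.inl (Or.inl ⟨u, l, rfl, rfl⟩)⟩
        have := congrArg Vertex.level h
        simp [Vertex.level_mk hd hA] at this
      refine ⟨z, hz, Set.Subset.trans ?_ hsub, p.concat hadj, ?_⟩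
      · rintro _ ⟨y, hy, rfl⟩
        simp only [Vertex.map_mk, wordMap_append]
        exact ⟨_, wordMap_image_subset hJ [l] ⟨y, hy, rfl⟩, rfl⟩
      · rw [SimpleGraph.Walk.length_concat, List.length_append, List.length_singleton]; omega
    · exact ⟨_, Vertex.level_mk hd hA _, subset_rfl, SimpleGraph.Walk.nil, by simp⟩

theorem eq_root_of_level_eq_zero (hd : 0 < d) (hA : Expanding A) {x : Vertex A D}
    (h : x.level = 0) : x = root A D := by
  obtain ⟨u, rfl⟩ := x.mk_surjective
  rw [Vertex.level_mk hd hA, List.length_eq_zero_iff] at h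
  rw [h, root]

theorem symbolicGraph_connected (hd : 0 < d) (hA : Expanding A)
    (hJ : ∀ t ∈ D, affMap A t '' J ⊆ J) : (symbolicGraph A D J).Connected := by
  have h : ∀ x, (symbolicGraph A D J).Reachable (root A D) x := fun x => by
    obtain ⟨z, hz, -, p, -⟩ := exists_ancestor hd hA hJ x (Nat.zero_le _)
    rw [← eq_root_of_level_eq_zero hd hA hz]
    exact ⟨p⟩
  have : Nonempty (Vertex A D) := ⟨root A D⟩
  exact ⟨fun x y => (h x).symm.trans (h y)⟩

theorem level_le_of_walk (hd : 0 < d) (hA : Expanding A) {x y : Vertex A D}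
    (p : (symbolicGraph A D J).Walk x y) : y.level ≤ x.level + p.length := by
  induction p with
  | nil => simp
  | cons h p ih =>
    have := level_le_of_adj hd hA h
    rw [SimpleGraph.Walk.length_cons]; omega

theorem dist_root (hd : 0 < d) (hA : Expanding A) (hJ : ∀ t ∈ D, affMap A t '' J ⊆ J)
    (x : Vertex A D) : (symbolicGraph A D J).dist (root A D) x = x.level := by
  apply le_antisymm
  · obtain ⟨z, hz, -, p, hp⟩ := exists_ancestor hd hA hJ x (Nat.zero_le _)
    rw [← eq_root_of_level_eq_zero hd hA hz]
    exact (SimpleGraph.dist_le p).trans (by omega)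
  · obtain ⟨p, hp⟩ := (symbolicGraph_connected hd hA hJ).exists_walk_length_eq_dist (root A D) x
    have := level_le_of_walk hd hA p
    rwa [hp, root, Vertex.level_mk hd hA, List.length_nil, zero_add] at this

end SelfAffine

/-! ### Codings of rooted graphs, and two auxiliary estimates. -/

namespace HypGraph

/-- A coding of a rooted graph by points of a space with an expanding group `L`: the Gromov product
of `x` and `y` is, up to a bounded error, the largest `k` such that `L k (P x - P y)` is bounded. -/
structure IsCoding {V E : Type*} [NormedAddCommGroup E] [NormedSpace ℝ E] (G : SimpleGraph V)
    (o : V) (L : ℤ → E →L[ℝ] E) (P : V → E) : Prop where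
  expanding : ExpandingGroup L
  connected : G.Connected
  upper : ∃ C : ℝ, ∀ (x y : V) (k : ℤ), (k : ℝ) ≤ gromovProduct G o x y → ‖L k (P x - P y)‖ ≤ C
  lower : ∃ c : ℝ, 0 < c ∧ ∀ (x y : V) (k : ℕ), k ≤ G.dist o x → k ≤ G.dist o y →
    ‖L k (P x - P y)‖ < c → (k : ℝ) - 1 / 2 ≤ gromovProduct G o x y

end HypGraph

theorem summable_pow_natAbs {lam : ℝ} (h0 : 0 < lam) (h1 : lam < 1) :
    Summable fun n : ℤ => lam ^ n.natAbs := by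
  refine Summable.of_nat_of_neg ?_ ?_ <;>
    simpa using summable_geometric_of_lt_one h0.le h1

theorem sum_pow_natAbs_le {lam : ℝ} (h0 : 0 < lam) (h1 : lam < 1) (s : ℤ) (n : ℕ) :
    ∑ i ∈ Finset.range n, lam ^ ((i : ℤ) - s).natAbs ≤ ∑' n : ℤ, lam ^ n.natAbs := by
  have hinj : Function.Injective fun i : ℕ => (i : ℤ) - s := fun i j h => by
    simpa using h
  have := (summable_pow_natAbs h0 h1).sum_le_tsum
    ((Finset.range n).map ⟨_, hinj⟩) (fun _ _ => by positivity)
  simpa using this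

theorem abs_sub_le_of_step {f : ℕ → ℕ} {n : ℕ}
    (hf : ∀ i < n, f (i + 1) ≤ f i + 1 ∧ f i ≤ f (i + 1) + 1) {i : ℕ} (hi : i ≤ n) :
    f 0 ≤ f i + i ∧ f n ≤ f i + (n - i) := by
  constructor
  · induction i with
    | zero => simp
    | succ i ih => have := ih (by omega); have := hf i (by omega); omega
  · obtain ⟨j, rfl⟩ := Nat.exists_eq_add_of_le hi
    clear hi
    induction j with
    | zero => simp
    | succ j ih =>
      have := ih (fun i' hi' => hf i' (by omega))
      have := hf (i + j) (by omega)
      rw [← add_assoc]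
      omega

/-! ### The symbolic graph is coded by the images of a point. -/

namespace SelfAffine

variable {d : ℕ} {A : Matrix (Fin d) (Fin d) ℤ} {D : Finset (Fin d → ℤ)}
  {J K : Set (EuclideanSpace ℝ (Fin d))}

theorem exists_norm_adj_le (hd : 0 < d) (hA : Expanding A) (hJ : Bornology.IsBounded J)
    (κ : EuclideanSpace ℝ (Fin d)) :
    ∃ M : ℝ, ∀ x y : Vertex A D, (symbolicGraph A D J).Adj x y →
      ‖powMap A x.level (x.map κ - y.map κ)‖ ≤ M := by
  have hL := hA.expandingGroup
  obtain ⟨R, hR⟩ := hJ.exists_norm_le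
  set M₁ : ℝ := ∑ l ∈ D, ‖κ - affMap A l κ‖ with hM₁
  have hchild : ∀ x y : Vertex A D, IsChild A D x y →
      ‖powMap A x.level (x.map κ - y.map κ)‖ ≤ M₁ := by
    rintro _ _ ⟨u, l, rfl, rfl⟩
    have : (Vertex.mk A D (u ++ [l])).map κ = (Vertex.mk A D u).map (affMap A l.1 κ) := by
      simp [wordMap_append, wordMap]
    rw [this, powMap_map_sub hd hA]
    exact Finset.single_le_sum (f := fun l => ‖κ - affMap A l κ‖) (fun _ _ => norm_nonneg _) l.2
  -- The three terms treat an edge to a child, an edge to a parent (measured one level deeper, hence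
  -- ‖A‖), and a horizontal edge. In the last case a common point of the cells reduces the
  -- difference to one of two points of J.
  refine ⟨max M₁ (max (‖powMap A 1‖ * M₁) (R + R)), fun x y h => ?_⟩
  rcases h.2 with (h | h) | h
  · exact (hchild x y h).trans (le_max_left _ _)
  · refine le_trans ?_ ((le_max_left _ _).trans (le_max_right _ _))
    rw [level_of_isChild hd hA h, Nat.cast_add, Nat.cast_one, add_comm, hL.add,
      ← norm_neg, ← map_neg, ← map_neg, neg_sub]
    exact ((powMap A 1).le_opNorm _).trans (by gcongr; exact hchild y x h)
  · refine le_trans ?_ ((le_max_right _ _).trans (le_max_right _ _))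
    have hlev := level_of_cellsMeet hd hA h
    obtain ⟨u, v, -, -, rfl, rfl, z, ⟨j, hj, hjz⟩, ⟨j', hj', hjz'⟩⟩ := h
    have e : (Vertex.mk A D u).map κ - (Vertex.mk A D v).map κ =
        ((Vertex.mk A D u).map κ - (Vertex.mk A D u).map j) +
          ((Vertex.mk A D v).map j' - (Vertex.mk A D v).map κ) := by
      simp only [Vertex.map_mk, hjz, hjz']
      abel
    rw [e, map_add, powMap_map_sub hd hA, hlev, powMap_map_sub hd hA]
    have e2 : κ - j + (j' - κ) = j' - j := by abel
    rw [e2]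
    exact (norm_sub_le _ _).trans (add_le_add (hR _ hj') (hR _ hj))

/-- The difference telescopes along a geodesic. Its i-th vertex has level at least max(|x| - i, |y|
- (n - i)), where n is the length, so the i-th term is of order lam^|i - s|, with s the index where
the two bounds balance. -/
theorem exists_upper (hd : 0 < d) (hA : Expanding A) (hJb : Bornology.IsBounded J)
    (hJ : ∀ t ∈ D, affMap A t '' J ⊆ J) (κ : EuclideanSpace ℝ (Fin d)) :
    ∃ C : ℝ, ∀ (x y : Vertex A D) (k : ℤ),
      (k : ℝ) ≤ HypGraph.gromovProduct (symbolicGraph A D J) (root A D) x y →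
        ‖powMap A k (x.map κ - y.map κ)‖ ≤ C := by
  have hL := hA.expandingGroup
  obtain ⟨M, hM⟩ := exists_norm_adj_le (D := D) hd hA hJb κ
  obtain ⟨C, lam, hC, h0, h1, hdec⟩ := hL.decay
  refine ⟨C * max M 0 * ∑' n : ℤ, lam ^ n.natAbs, fun x y k hk => ?_⟩
  obtain ⟨p, hp⟩ := (symbolicGraph_connected hd hA hJ).exists_walk_length_eq_dist x y
  rw [HypGraph.gromovProduct, dist_root hd hA hJ, dist_root hd hA hJ, ← hp,
    le_div_iff₀ two_pos] at hk
  have hk' : k * 2 + (p.length : ℤ) ≤ x.level + y.level := by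
    have : (k : ℝ) * 2 + p.length ≤ x.level + y.level := by linarith
    exact_mod_cast this
  have hadj : ∀ i < p.length, (symbolicGraph A D J).Adj (p.getVert i) (p.getVert (i + 1)) :=
    fun i hi => p.adj_getVert_succ hi
  have hlev : ∀ i ≤ p.length, x.level ≤ (p.getVert i).level + i ∧
      y.level ≤ (p.getVert i).level + (p.length - i) := by
    intro i hi
    have := abs_sub_le_of_step (f := fun i => (p.getVert i).level) (n := p.length)
      (fun j hj => ⟨level_le_of_adj hd hA (hadj j hj), level_le_of_adj hd hA (hadj j hj).symm⟩) hi
    simpa using this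
  have hsum : x.map κ - y.map κ = ∑ i ∈ Finset.range p.length,
      ((p.getVert i).map κ - (p.getVert (i + 1)).map κ) := by
    rw [Finset.sum_range_sub']
    simp
  set s : ℤ := ((x.level : ℤ) - y.level + p.length) / 2 with hs
  rw [hsum, map_sum]
  refine (norm_sum_le _ _).trans ?_
  refine le_trans ?_ (mul_le_mul_of_nonneg_left (sum_pow_natAbs_le h0 h1 s p.length)
    (by positivity))
  rw [Finset.mul_sum]
  refine Finset.sum_le_sum fun i hi => ?_
  rw [Finset.mem_range] at hi
  have hl := hlev i hi.le
  -- The rounding in s is harmless because k is an integer with 2k + n ≤ |x| + |y|.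
  have hle : (((i : ℤ) - s).natAbs : ℤ) ≤ (p.getVert i).level - k := by omega
  obtain ⟨m, hm⟩ := Int.eq_ofNat_of_zero_le (le_trans (by positivity) hle)
  have hk2 : k = -(m : ℤ) + (p.getVert i).level := by omega
  rw [hk2, hL.add]
  refine (hdec m _).trans ?_
  have hpow : lam ^ m ≤ lam ^ ((i : ℤ) - s).natAbs :=
    pow_le_pow_of_le_one h0.le h1.le (by omega)
  have := (hM _ _ (hadj i hi)).trans (le_max_left M 0)
  calc C * lam ^ m * _ ≤ C * lam ^ ((i : ℤ) - s).natAbs * max M 0 := by gcongr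
    _ = _ := by ring

/-- Integral translates of a compact set that do not meet have a definite distance. -/
theorem exists_pos_of_translates {J : Set (EuclideanSpace ℝ (Fin d))} (hJ : IsCompact J) :
    ∃ c : ℝ, 0 < c ∧ ∀ s t : Fin d → ℤ, ∀ p ∈ J, ∀ q ∈ J,
      ‖(p + intVec s) - (q + intVec t)‖ < c →
        ∃ p' ∈ J, ∃ q' ∈ J, p' + intVec s = q' + intVec t := by
  set F : Set (EuclideanSpace ℝ (Fin d)) :=
    (fun z : EuclideanSpace ℝ (Fin d) × EuclideanSpace ℝ (Fin d) => z.1 - z.2) '' (J ×ˢ J) with hF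
  have hFc : IsCompact F := (hJ.prod hJ).image (by fun_prop)
  obtain ⟨R, hR⟩ := hFc.isBounded.exists_norm_le
  -- Only these relative translations can bring two points of J within distance 1; outside this
  -- finite set nothing is required.
  have hfin : Set.Finite {t : Fin d → ℤ | ‖intVec t‖ ≤ R + 1} := by
    refine (Set.Finite.pi' (t := fun _ : Fin d => {z : ℤ | |(z : ℝ)| ≤ R + 1}) fun _ => ?_).subset ?_
    · refine (Set.finite_Icc (-⌈R + 1⌉) ⌈R + 1⌉).subset fun z hz => ?_
      rw [Set.mem_ofPred_eq, abs_le] at hz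
      have h3 := Int.le_ceil (R + 1)
      constructor
      · have : (-(⌈R + 1⌉ : ℤ) : ℝ) ≤ z := by linarith
        exact_mod_cast this
      · have : (z : ℝ) ≤ ⌈R + 1⌉ := by linarith
        exact_mod_cast this
    · intro t ht i
      rw [Set.mem_ofPred_eq] at ht
      refine le_trans ?_ ht
      have := PiLp.norm_apply_le (p := 2) (intVec t) i
      simpa [intVec] using this
  have hpos : ∀ t ∈ hfin.toFinset, ∃ c : ℝ, 0 < c ∧ ∀ f ∈ F, ‖f + intVec t‖ < c → -intVec t ∈ F := by
    intro t _
    -- Membership says that the two translates meet. Otherwise the point has positive distance to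
    -- the closed set J - J.
    by_cases ht : -intVec t ∈ F
    · exact ⟨1, one_pos, fun _ _ _ => ht⟩
    · obtain ⟨c, hc, hcF⟩ := Metric.isOpen_iff.1 hFc.isClosed.isOpen_compl _ ht
      refine ⟨c, hc, fun f hf hfc => absurd hf (hcF ?_)⟩
      rw [Metric.mem_ball, dist_eq_norm, sub_neg_eq_add]
      exact hfc
  choose! c hc hcF using hpos
  obtain ⟨c₀, hc₀, hle⟩ : ∃ c₀ : ℝ, 0 < c₀ ∧ ∀ t ∈ hfin.toFinset, c₀ ≤ c t := by
    rcases hfin.toFinset.eq_empty_or_nonempty with he | hne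
    · exact ⟨1, one_pos, by simp [he]⟩
    · obtain ⟨t, ht, hmin⟩ := hfin.toFinset.exists_min_image c hne
      exact ⟨c t, hc t ht, hmin⟩
  refine ⟨min c₀ 1, lt_min hc₀ one_pos, fun s t p hp q hq h => ?_⟩
  have hpq : p - q ∈ F := ⟨(p, q), ⟨hp, hq⟩, rfl⟩
  have e : (p + intVec s) - (q + intVec t) = (p - q) + intVec (s - t) := by
    rw [intVec_sub]; abel
  rw [e] at h
  have hmem : s - t ∈ hfin.toFinset := by
    rw [Set.Finite.mem_toFinset, Set.mem_ofPred_eq]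
    have h1 := norm_sub_le ((p - q) + intVec (s - t)) (p - q)
    rw [add_sub_cancel_left] at h1
    linarith [hR _ hpq, min_le_right c₀ 1]
  obtain ⟨⟨p', q'⟩, ⟨hp', hq'⟩, he⟩ :=
    hcF _ hmem _ hpq (h.trans_le ((min_le_left _ _).trans (hle _ hmem)))
  refine ⟨p', hp', q', hq', ?_⟩
  rw [intVec_sub] at he
  have : p' - q' = -(intVec s - intVec t) := he
  rw [← sub_eq_zero]
  calc p' + intVec s - (q' + intVec t) = (p' - q') + (intVec s - intVec t) := by abel
    _ = 0 := by rw [this]; abel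

/-- After applying A^k, the level-k ancestor cells become integral translates of J. If they are
close, they meet, so the path x → z → w → y has length at most |x| + |y| - 2k + 1; the last 1 is the
source of the 1/2. -/
theorem exists_lower (hd : 0 < d) (hA : Expanding A) (hJc : IsCompact J)
    (hJ : ∀ t ∈ D, affMap A t '' J ⊆ J) {κ : EuclideanSpace ℝ (Fin d)} (hκ : κ ∈ J) :
    ∃ c : ℝ, 0 < c ∧ ∀ (x y : Vertex A D) (k : ℕ),
      k ≤ (symbolicGraph A D J).dist (root A D) x → k ≤ (symbolicGraph A D J).dist (root A D) y →
        ‖powMap A k (x.map κ - y.map κ)‖ < c →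
          (k : ℝ) - 1 / 2 ≤ HypGraph.gromovProduct (symbolicGraph A D J) (root A D) x y := by
  have hL := hA.expandingGroup
  obtain ⟨c, hc, hcJ⟩ := exists_pos_of_translates hJc
  refine ⟨c, hc, fun x y k hkx hky h => ?_⟩
  rw [dist_root hd hA hJ] at hkx hky
  obtain ⟨z, hz, hzx, p, hp⟩ := exists_ancestor hd hA hJ x hkx
  obtain ⟨w, hw, hwy, p', hp'⟩ := exists_ancestor hd hA hJ y hky
  obtain ⟨j, hj, hjx⟩ := hzx ⟨κ, hκ, rfl⟩
  obtain ⟨j', hj', hjy⟩ := hwy ⟨κ, hκ, rfl⟩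
  obtain ⟨s, hs⟩ := exists_map_eq hd hA z
  obtain ⟨t, ht⟩ := exists_map_eq hd hA w
  rw [← hjx, ← hjy, hs, ht, hz, hw, ← map_sub, hL.self_neg] at h
  obtain ⟨i, hi, i', hi', he⟩ := hcJ s t j hj j' hj' h
  have hmeet : z.map i = w.map i' := by rw [hs, ht, he, hz, hw]
  have hdist : (symbolicGraph A D J).dist z w ≤ 1 := by
    by_cases hzw : z = w
    · simp [hzw]
    · have hadj : (symbolicGraph A D J).Adj z w := by
        refine ⟨hzw, Or.inr ?_⟩
        obtain ⟨u, rfl⟩ := z.mk_surjective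
        obtain ⟨v, rfl⟩ := w.mk_surjective
        rw [Vertex.level_mk hd hA] at hz hw
        refine ⟨u, v, ?_, hz.trans hw.symm, rfl, rfl, _, ⟨i, hi, rfl⟩, ⟨i', hi', hmeet.symm⟩⟩
        by_contra hu
        have hu0 : u.length = 0 := by omega
        have hv0 : v.length = 0 := by omega
        rw [List.length_eq_zero_iff] at hu0 hv0
        exact hzw (by rw [hu0, hv0])
      rw [SimpleGraph.dist_eq_one_iff_adj.2 hadj]
  have hconn := symbolicGraph_connected hd hA hJ
  have h1 := hconn.dist_triangle (u := x) (v := z) (w := y)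
  have h2 := hconn.dist_triangle (u := z) (v := w) (w := y)
  have h3 := SimpleGraph.dist_le p
  have h4 := SimpleGraph.dist_le p'
  rw [SimpleGraph.dist_comm] at h3
  have hfin : (symbolicGraph A D J).dist x y + 2 * k ≤ x.level + y.level + 1 := by omega
  have hfin' : ((symbolicGraph A D J).dist x y : ℝ) + 2 * k ≤ x.level + y.level + 1 := by
    exact_mod_cast hfin
  rw [HypGraph.gromovProduct, dist_root hd hA hJ, dist_root hd hA hJ]
  linarith

theorem isCoding_symbolicGraph (hd : 0 < d) (hA : Expanding A) (hJ : IsInvariantSet A D J)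
    {κ : EuclideanSpace ℝ (Fin d)} (hκ : κ ∈ J) :
    HypGraph.IsCoding (symbolicGraph A D J) (root A D) (powMap A) fun x => x.map κ where
  expanding := hA.expandingGroup
  connected := symbolicGraph_connected hd hA hJ.2.2.2
  upper := exists_upper hd hA hJ.2.1 hJ.2.2.2 κ
  lower := exists_lower hd hA (Metric.isCompact_of_isClosed_isBounded hJ.2.2.1 hJ.2.1) hJ.2.2.2 hκ

theorem IsSelfAffineSet.exists_word (hK : IsSelfAffineSet A D K) (n : ℕ)
    {p : EuclideanSpace ℝ (Fin d)} (hp : p ∈ K) :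
    ∃ u : List D, u.length = n ∧ p ∈ wordMap A D u '' K := by
  induction n generalizing p with
  | zero => exact ⟨[], rfl, p, hp, rfl⟩
  | succ n ih =>
    rw [hK.2.2] at hp
    simp only [Set.mem_iUnion] at hp
    obtain ⟨t, ht, q, hq, rfl⟩ := hp
    obtain ⟨u, hu, z, hz, rfl⟩ := ih hq
    exact ⟨⟨t, ht⟩ :: u, by simp [hu], z, hz, rfl⟩

theorem IsSelfAffineSet.isInvariantSet (hK : IsSelfAffineSet A D K) : IsInvariantSet A D K := by
  refine ⟨hK.1, hK.2.1.isBounded, hK.2.1.isClosed, fun t ht => ?_⟩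
  conv_rhs => rw [hK.2.2]
  exact Set.subset_biUnion_of_mem (u := fun t => affMap A t '' K) ht

theorem wordMap_sub (hA : Expanding A) (u : List D) (x y : EuclideanSpace ℝ (Fin d)) :
    wordMap A D u x - wordMap A D u y = powMap A (-(u.length : ℤ)) (x - y) := by
  obtain ⟨t, ht⟩ := exists_wordMap_eq hA u
  rw [ht, ht, ← map_sub]
  congr 1
  abel

/-- The attractor lies in every closed bounded invariant set. -/
theorem IsSelfAffineSet.subset (hA : Expanding A) (hK : IsSelfAffineSet A D K)
    (hJ : IsInvariantSet A D J) : K ⊆ J := by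
  intro p hp
  obtain ⟨j, hj⟩ := hJ.1
  obtain ⟨R, hR⟩ := hK.2.1.isBounded.exists_norm_le
  rw [← hJ.2.2.1.closure_eq, Metric.mem_closure_iff]
  intro ε hε
  obtain ⟨N, hN⟩ := hA.expandingGroup.exists_nat (R + ‖j‖) hε
  obtain ⟨u, hu, q, hq, rfl⟩ := hK.exists_word N hp
  refine ⟨_, wordMap_image_subset hJ.2.2.2 u ⟨j, hj, rfl⟩, ?_⟩
  rw [dist_eq_norm, wordMap_sub hA, hu]
  exact hN N le_rfl _ ((norm_sub_le _ _).trans (add_le_add_left (hR q hq) _))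

/-- Every point of the attractor is approximated by the vertices of the symbolic graph. -/
theorem IsSelfAffineSet.exists_vertex_tendsto (hd : 0 < d) (hA : Expanding A)
    (hK : IsSelfAffineSet A D K) (hJ : ∀ t ∈ D, affMap A t '' J ⊆ J)
    (κ : EuclideanSpace ℝ (Fin d)) {p : EuclideanSpace ℝ (Fin d)} (hp : p ∈ K) :
    ∃ x : ℕ → Vertex A D,
      Tendsto (fun n => (symbolicGraph A D J).dist (root A D) (x n)) atTop atTop ∧
        Tendsto (fun n => (x n).map κ) atTop (𝓝 p) := by
  choose u hu q hq hqp using fun n => hK.exists_word n hp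
  refine ⟨fun n => Vertex.mk A D (u n), ?_, ?_⟩
  · simp only [dist_root hd hA hJ, Vertex.level_mk hd hA, hu]
    exact tendsto_id
  · obtain ⟨R, hR⟩ := hK.2.1.isBounded.exists_norm_le
    rw [Metric.tendsto_atTop]
    intro ε hε
    obtain ⟨N, hN⟩ := hA.expandingGroup.exists_nat (‖κ‖ + R) hε
    refine ⟨N, fun n hn => ?_⟩
    rw [dist_eq_norm, Vertex.map_mk, ← hqp n, wordMap_sub hA, hu]
    exact hN n (by exact_mod_cast hn) _
      ((norm_sub_le _ _).trans (add_le_add_right (hR _ (hq n)) _))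

/-- Keeps the codes in a compact set, so that Cauchy sequences of codes converge in K. -/
theorem IsSelfAffineSet.vertex_map_mem (hK : IsSelfAffineSet A D K)
    {κ : EuclideanSpace ℝ (Fin d)} (hκ : κ ∈ K) (x : Vertex A D) : x.map κ ∈ K := by
  obtain ⟨u, rfl⟩ := x.mk_surjective
  exact wordMap_image_subset hK.isInvariantSet.2.2.2 u ⟨κ, hκ, rfl⟩

end SelfAffine

/-! ### Hyperbolicity and boundary of a coded graph. -/

namespace HypGraph

variable {V E : Type*} [NormedAddCommGroup E] [NormedSpace ℝ E] {G : SimpleGraph V} {o : V}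
  {L : ℤ → E →L[ℝ] E} {P : V → E} {K : Set E} {a : ℝ}

theorem gromovProduct_le_left (hG : G.Connected) (x y : V) :
    gromovProduct G o x y ≤ G.dist o x := by
  have h : (G.dist o y : ℝ) ≤ G.dist o x + G.dist x y := by
    exact_mod_cast hG.dist_triangle
  rw [gromovProduct]
  linarith

theorem gromovProduct_le_right (hG : G.Connected) (x y : V) :
    gromovProduct G o x y ≤ G.dist o y := by
  have h : (G.dist o x : ℝ) ≤ G.dist o y + G.dist y x := by
    exact_mod_cast hG.dist_triangle
  rw [SimpleGraph.dist_comm (u := y)] at h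
  rw [gromovProduct]
  linarith

theorem gromovProduct_nonneg (hG : G.Connected) (x y : V) : 0 ≤ gromovProduct G o x y := by
  have h : (G.dist x y : ℝ) ≤ G.dist x o + G.dist o y := by
    exact_mod_cast hG.dist_triangle
  rw [SimpleGraph.dist_comm (u := x) (v := o)] at h
  rw [gromovProduct]
  linarith

theorem IsCoding.hyperbolic (h : IsCoding G o L P) : Hyperbolic G o := by
  obtain ⟨C, hC⟩ := h.upper
  obtain ⟨c, hc, hlow⟩ := h.lower
  obtain ⟨N, hN⟩ := h.expanding.exists_nat (C + C) hc
  -- N shifts take 2C below the threshold of `lower`; 1/2 comes from `lower` and 1 from rounding the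
  -- minimum down.
  refine ⟨h.connected, N + 3 / 2, by positivity, fun x y z => ?_⟩
  set g := min (gromovProduct G o x z) (gromovProduct G o z y) with hg
  have hg0 : 0 ≤ g := le_min (gromovProduct_nonneg h.connected _ _)
    (gromovProduct_nonneg h.connected _ _)
  have hfl : (⌊g⌋₊ : ℝ) ≤ g := Nat.floor_le hg0
  have hfl2 : g < ⌊g⌋₊ + 1 := Nat.lt_floor_add_one g
  generalize ⌊g⌋₊ = k at hfl hfl2
  rcases lt_or_ge k N with hlt | hle
  · have : (k : ℝ) ≤ N := by exact_mod_cast hlt.le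
    have := gromovProduct_nonneg (o := o) h.connected x y
    linarith
  obtain ⟨j, rfl⟩ : ∃ j, k = j + N := ⟨k - N, by omega⟩
  have hkx : j + N ≤ G.dist o x := by
    have := (hfl.trans (min_le_left _ _)).trans (gromovProduct_le_left h.connected x z)
    exact_mod_cast this
  have hky : j + N ≤ G.dist o y := by
    have := (hfl.trans (min_le_right _ _)).trans (gromovProduct_le_right h.connected z y)
    exact_mod_cast this
  have h1 := hC x z (j + N : ℕ) (by exact_mod_cast hfl.trans (min_le_left _ _))
  have h2 := hC z y (j + N : ℕ) (by exact_mod_cast hfl.trans (min_le_right _ _))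
  have h3 : ‖L ((j + N : ℕ) : ℤ) (P x - P y)‖ ≤ C + C := by
    rw [show P x - P y = (P x - P z) + (P z - P y) by abel, map_add]
    exact (norm_add_le _ _).trans (add_le_add h1 h2)
  have h4 := hN N le_rfl _ h3
  rw [← h.expanding.add, show (-(N : ℤ) + ((j + N : ℕ) : ℤ)) = (j : ℕ) by push_cast; ring] at h4
  have h5 := hlow x y j (by omega) (by omega) h4
  push_cast at hfl2
  linarith

theorem exp_le_visual (ha : 0 < a) {x y : V} (hxy : x ≠ y) {s : ℝ}
    (h : gromovProduct G o x y ≤ s) : Real.exp (-a * s) ≤ visual G o a x y := by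
  rw [visual, if_neg hxy]
  exact Real.exp_le_exp.2 (by nlinarith)

theorem visual_le_exp (ha : 0 < a) {x y : V} {s : ℝ}
    (h : s ≤ gromovProduct G o x y) : visual G o a x y ≤ Real.exp (-a * s) := by
  rw [visual]
  split_ifs
  · positivity
  · exact Real.exp_le_exp.2 (by nlinarith)

section Filters

variable {ι : Type*} {F : Filter ι} {x y : ι → V}

/-- Where x i = y i, smallness of ρ_a says nothing; there the product is |x i|, which is large by
the first hypothesis. -/
theorem eventually_le_gromovProduct (ha : 0 < a)
    (hx : Tendsto (fun i => G.dist o (x i)) F atTop)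
    (h : Tendsto (fun i => visual G o a (x i) (y i)) F (𝓝 0)) (s : ℝ) :
    ∀ᶠ i in F, s ≤ gromovProduct G o (x i) (y i) := by
  have hx' := tendsto_natCast_atTop_atTop (R := ℝ) |>.comp hx
  filter_upwards [hx'.eventually_ge_atTop s, h.eventually_lt_const (Real.exp_pos (-a * s))]
    with i hi1 hi2
  by_cases hxy : x i = y i
  · rw [gromovProduct, ← hxy, SimpleGraph.dist_self]
    have : s ≤ (G.dist o (x i) : ℝ) := hi1
    simpa using this
  · by_contra! hlt
    exact absurd (exp_le_visual ha hxy hlt.le) hi2.not_ge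

theorem IsCoding.tendsto_sub (h : IsCoding G o L P) (ha : 0 < a)
    (hx : Tendsto (fun i => G.dist o (x i)) F atTop)
    (hxy : Tendsto (fun i => visual G o a (x i) (y i)) F (𝓝 0)) :
    Tendsto (fun i => P (x i) - P (y i)) F (𝓝 0) := by
  obtain ⟨C, hC⟩ := h.upper
  rw [Metric.tendsto_nhds]
  intro ε hε
  obtain ⟨N, hN⟩ := h.expanding.exists_nat C hε
  filter_upwards [eventually_le_gromovProduct ha hx hxy (N : ℤ)] with i hi
  have := hN N le_rfl _ (hC _ _ _ hi)
  rwa [h.expanding.neg_self, ← dist_zero_right] at this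

/-- Extends `lower` to negative k, needed for far apart points, where nonnegativity of the product
suffices. -/
theorem IsCoding.eventually_le_gromovProduct (h : IsCoding G o L P) :
    ∃ c : ℝ, 0 < c ∧ ∀ (ι : Type) (F : Filter ι) (x y : ι → V) (k : ℤ),
      Tendsto (fun i => G.dist o (x i)) F atTop → Tendsto (fun i => G.dist o (y i)) F atTop →
        (∀ᶠ i in F, ‖L k (P (x i) - P (y i))‖ < c) →
          ∀ᶠ i in F, (k : ℝ) - 1 / 2 ≤ gromovProduct G o (x i) (y i) := by
  obtain ⟨c, hc, hlow⟩ := h.lower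
  refine ⟨c, hc, fun ι F x y k hx hy hxy => ?_⟩
  rcases le_or_gt 0 k with hk | hk
  · lift k to ℕ using hk
    filter_upwards [hx.eventually_ge_atTop k, hy.eventually_ge_atTop k, hxy] with i h1 h2 h3
    exact_mod_cast hlow _ _ _ h1 h2 h3
  · refine Eventually.of_forall fun i => ?_
    have h1 : (k : ℝ) < 0 := by exact_mod_cast hk
    have := gromovProduct_nonneg (o := o) h.connected (x i) (y i)
    linarith

end Filters

theorem IsCoding.tendsto_visual (h : IsCoding G o L P) (ha : 0 < a)
    {ι : Type} {F : Filter ι} {x y : ι → V}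
    (hx : Tendsto (fun i => G.dist o (x i)) F atTop)
    (hy : Tendsto (fun i => G.dist o (y i)) F atTop)
    (hxy : Tendsto (fun i => P (x i) - P (y i)) F (𝓝 0)) :
    Tendsto (fun i => visual G o a (x i) (y i)) F (𝓝 0) := by
  obtain ⟨c, hc, hlow⟩ := h.eventually_le_gromovProduct
  have hexp : Tendsto (fun k : ℕ => Real.exp (-a * ((k : ℝ) - 1 / 2))) atTop (𝓝 0) := by
    refine Real.tendsto_exp_atBot.comp ?_
    refine Tendsto.const_mul_atTop_of_neg (by linarith) ?_
    exact tendsto_atTop_add_const_right _ _ tendsto_natCast_atTop_atTop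
  rw [Metric.tendsto_nhds]
  intro ε hε
  obtain ⟨k, hk⟩ := (hexp.eventually_lt_const hε).exists
  have hLk : ∀ᶠ i in F, ‖L k (P (x i) - P (y i))‖ < c := by
    have := ((L k).continuous.tendsto 0).comp hxy
    rw [map_zero] at this
    have h2 := this.norm
    rw [norm_zero] at h2
    exact h2.eventually_lt_const hc
  filter_upwards [hlow ι F x y k hx hy hLk] with i hi
  rw [dist_zero_right, Real.norm_of_nonneg (visual_nonneg _ _ _ _ _)]
  exact (visual_le_exp ha (by exact_mod_cast hi)).trans_lt hk

section Boundary

variable {hX : Hyperbolic G o} {ha : 0 < a}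

/-- Distinct vertices, one of them in the ball of radius R, have ρ_a at least e^(-aR). A Cauchy
sequence that keeps returning to a ball is therefore eventually constant, and represents a vertex.
-/
theorem tendsto_dist_of_not_mem_range {x : CauchySeqs G o a}
    (hx : Completion.mk hX ha x ∉ Set.range (Completion.ofVertex hX ha)) :
    Tendsto (fun n => G.dist o (x.1 n)) atTop atTop := by
  by_contra hne
  rw [tendsto_atTop] at hne
  push Not at hne
  obtain ⟨R, hR⟩ := hne
  have hev := x.2.eventually_lt_const (Real.exp_pos (-a * R))
  obtain ⟨⟨N₁, N₂⟩, hN⟩ := eventually_atTop.1 hev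
  obtain ⟨m, hm, hmR⟩ := (frequently_atTop.1 hR) (max N₁ N₂)
  have hconst : ∀ n, max N₁ N₂ ≤ n → x.1 n = x.1 m := by
    intro n hn
    by_contra hnm
    have h1 := hN (m, n) ⟨(le_max_left _ _).trans hm, (le_max_right _ _).trans hn⟩
    have h2 : gromovProduct G o (x.1 m) (x.1 n) ≤ R :=
      (gromovProduct_le_left hX.1 _ _).trans (by exact_mod_cast hmR.le)
    exact absurd (exp_le_visual ha (Ne.symm hnm) h2) h1.not_ge
  refine hx ⟨x.1 m, Quotient.sound (s := cauchySetoid hX ha) ?_⟩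
  refine tendsto_const_nhds.congr' ?_
  filter_upwards [eventually_ge_atTop (max N₁ N₂)] with n hn
  rw [hconst n hn, visual_self]

theorem not_mem_range_of_tendsto_dist {x : CauchySeqs G o a}
    (hx : Tendsto (fun n => G.dist o (x.1 n)) atTop atTop) :
    Completion.mk hX ha x ∉ Set.range (Completion.ofVertex hX ha) := by
  rintro ⟨v, hv⟩
  have h : Tendsto (fun n => visual G o a v (x.1 n)) atTop (𝓝 0) :=
    Quotient.exact (s := cauchySetoid hX ha) hv
  have h' : Tendsto (fun n => visual G o a (x.1 n) v) atTop (𝓝 0) := by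
    simpa only [visual_comm] using h
  obtain ⟨n, hn⟩ := (HypGraph.eventually_le_gromovProduct ha hx h' (G.dist o v + 1)).exists
  have := gromovProduct_le_right (o := o) hX.1 (x.1 n) v
  linarith

/-- The limit map of the boundary of a coded graph onto the limit set. -/
theorem IsCoding.exists_boundaryMap (h : IsCoding G o L P) (hK : IsCompact K)
    (hPK : ∀ x, P x ∈ K)
    (hKP : ∀ p ∈ K, ∃ x : ℕ → V, Tendsto (fun n => G.dist o (x n)) atTop atTop ∧
      Tendsto (fun n => P (x n)) atTop (𝓝 p)) :
    ∃ Φ : Boundary hX ha → K, Function.Bijective Φ ∧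
      ∀ (ξ : Boundary hX ha) (x : CauchySeqs G o a), Completion.mk hX ha x = ξ.1 →
        Tendsto (fun n => P (x.1 n)) atTop (𝓝 (Φ ξ : E)) := by
  have hdist : ∀ (ξ : Boundary hX ha) (x : CauchySeqs G o a), Completion.mk hX ha x = ξ.1 →
      Tendsto (fun n => G.dist o (x.1 n)) atTop atTop := fun ξ x hx =>
    tendsto_dist_of_not_mem_range (hX := hX) (ha := ha) (hx ▸ ξ.2)
  have hrep : ∀ ξ : Boundary hX ha, ∃ x, Completion.mk hX ha x = ξ.1 := fun ξ =>
    Quotient.exists_rep (s := cauchySetoid hX ha) ξ.1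
  have hlim : ∀ ξ : Boundary hX ha, ∃ p : K, ∀ x : CauchySeqs G o a,
      Completion.mk hX ha x = ξ.1 → Tendsto (fun n => P (x.1 n)) atTop (𝓝 (p : E)) := by
    intro ξ
    obtain ⟨x, hx⟩ := hrep ξ
    have hxd := hdist ξ x hx
    have hc : CauchySeq fun n => P (x.1 n) := by
      rw [cauchySeq_iff_tendsto_dist_atTop_0]
      have hfst : Tendsto (Prod.fst : ℕ × ℕ → ℕ) atTop atTop := by
        rw [← prod_atTop_atTop_eq]; exact tendsto_fst
      have := (h.tendsto_sub ha (hxd.comp hfst) x.2).norm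
      simpa [dist_eq_norm] using this
    obtain ⟨p, hp, hxp⟩ := cauchySeq_tendsto_of_isComplete hK.isComplete (fun n => hPK (x.1 n)) hc
    refine ⟨⟨p, hp⟩, fun y hy => ?_⟩
    have hyx : Tendsto (fun n => visual G o a (y.1 n) (x.1 n)) atTop (𝓝 0) :=
      Quotient.exact (s := cauchySetoid hX ha) (hy.trans hx.symm)
    have := (h.tendsto_sub ha (hdist ξ y hy) hyx).add hxp
    simpa using this
  choose Φ hΦ using hlim
  -- Injectivity: equal limits force the code differences to 0, hence ρ_a to 0. Surjectivity: a
  -- sequence of vertices whose codes converge to p is Cauchy for the same reason.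
  refine ⟨Φ, ⟨fun ξ η he => ?_, fun p => ?_⟩, hΦ⟩
  · obtain ⟨x, hx⟩ := hrep ξ
    obtain ⟨y, hy⟩ := hrep η
    have hsub : Tendsto (fun n => P (x.1 n) - P (y.1 n)) atTop (𝓝 0) := by
      have := (hΦ ξ x hx).sub (hΦ η y hy)
      rwa [he, sub_self] at this
    refine Subtype.ext ?_
    rw [← hx, ← hy]
    exact Quotient.sound (s := cauchySetoid hX ha)
      (h.tendsto_visual ha (hdist ξ x hx) (hdist η y hy) hsub)
  · obtain ⟨x, hxd, hxp⟩ := hKP p p.2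
    have hfst : Tendsto (Prod.fst : ℕ × ℕ → ℕ) atTop atTop := by
      rw [← prod_atTop_atTop_eq]; exact tendsto_fst
    have hsnd : Tendsto (Prod.snd : ℕ × ℕ → ℕ) atTop atTop := by
      rw [← prod_atTop_atTop_eq]; exact tendsto_snd
    have hsub : Tendsto (fun n : ℕ × ℕ => P (x n.1) - P (x n.2)) atTop (𝓝 0) := by
      have := (hxp.comp hfst).sub (hxp.comp hsnd)
      rwa [sub_self] at this
    set X : CauchySeqs G o a := ⟨x, h.tendsto_visual ha (hxd.comp hfst) (hxd.comp hsnd) hsub⟩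
    refine ⟨⟨Completion.mk hX ha X, not_mem_range_of_tendsto_dist hxd⟩, Subtype.ext ?_⟩
    exact tendsto_nhds_unique (hΦ _ X rfl) hxp

theorem visualExt_mem_Icc {ξ η : Completion hX ha} {s t : ℝ}
    (hst : ∀ x y : CauchySeqs G o a, Completion.mk hX ha x = ξ → Completion.mk hX ha y = η →
      ∀ᶠ mn : ℕ × ℕ in atTop, s ≤ visual G o a (x.1 mn.1) (y.1 mn.2) ∧
        visual G o a (x.1 mn.1) (y.1 mn.2) ≤ t) :
    s ≤ visualExt hX ha ξ η ∧ visualExt hX ha ξ η ≤ t := by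
  have key : ∀ x y : CauchySeqs G o a, Completion.mk hX ha x = ξ → Completion.mk hX ha y = η →
      s ≤ limsup (fun mn : ℕ × ℕ => visual G o a (x.1 mn.1) (y.1 mn.2)) atTop ∧
      limsup (fun mn : ℕ × ℕ => visual G o a (x.1 mn.1) (y.1 mn.2)) atTop ≤ t := by
    intro x y hx hy
    have hp := hst x y hx hy
    refine ⟨le_limsup_of_frequently_le (hp.mono fun _ h => h.1).frequently
      (isBoundedUnder_of_eventually_le (hp.mono fun _ h => h.2)), limsup_le_of_le ?_
      (hp.mono fun _ h => h.2)⟩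
    exact (isBoundedUnder_of_eventually_ge (hp.mono fun _ h => h.1)).isCoboundedUnder_le
  obtain ⟨x, hx⟩ : ∃ x, Completion.mk hX ha x = ξ := Quotient.exists_rep ξ
  obtain ⟨y, hy⟩ : ∃ y, Completion.mk hX ha y = η := Quotient.exists_rep η
  unfold visualExt
  -- An infimum of reals over an empty family would be the default value 0.
  have : Nonempty {p : CauchySeqs G o a × CauchySeqs G o a //
      Completion.mk hX ha p.1 = ξ ∧ Completion.mk hX ha p.2 = η} := ⟨⟨(x, y), hx, hy⟩⟩
  refine ⟨le_ciInf fun p => (key _ _ p.2.1 p.2.2).1, ?_⟩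
  refine ciInf_le_of_le ⟨s, ?_⟩ ⟨(x, y), hx, hy⟩ (key x y hx hy).2
  rintro _ ⟨p, rfl⟩
  exact (key _ _ p.2.1 p.2.2).1

/-- The visual metric of two boundary points is determined, up to a bounded factor, by the scale
`k` of the difference of their limits. -/
theorem IsCoding.exists_visualExt_bounds (h : IsCoding G o L P) :
    ∃ c : ℝ, ∀ {a : ℝ} {ha : 0 < a} (ξ η : Boundary hX ha) (p q : E) (k : ℤ),
      (∀ x : CauchySeqs G o a, Completion.mk hX ha x = ξ.1 →
        Tendsto (fun n => P (x.1 n)) atTop (𝓝 p)) →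
      (∀ y : CauchySeqs G o a, Completion.mk hX ha y = η.1 →
        Tendsto (fun n => P (y.1 n)) atTop (𝓝 q)) →
      ‖L (k - 1) (p - q)‖ < 1 → 1 ≤ ‖L k (p - q)‖ →
        Real.exp (-a * (k + c)) ≤ visualExt hX ha ξ.1 η.1 ∧
          visualExt hX ha ξ.1 η.1 ≤ Real.exp (-a * (k - c)) := by
  obtain ⟨C, hC⟩ := h.upper
  obtain ⟨c, hc, hlow⟩ := h.eventually_le_gromovProduct
  obtain ⟨N, hN⟩ := h.expanding.exists_nat (‖L 1‖ + 1) hc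
  obtain ⟨M, hM⟩ := h.expanding.exists_nat_lt C (one_half_pos (α := ℝ))
  -- N takes vectors of size ‖A‖ + 1 below the threshold of `lower`; a product of at least k + M
  -- would contradict the choice of M; the 1 absorbs the 1/2.
  refine ⟨N + M + 1, fun {a ha} ξ η p q k hp hq hk1 hk2 => visualExt_mem_Icc fun x y hx hy => ?_⟩
  have hfst : Tendsto (Prod.fst : ℕ × ℕ → ℕ) atTop atTop := by
    rw [← prod_atTop_atTop_eq]; exact tendsto_fst
  have hsnd : Tendsto (Prod.snd : ℕ × ℕ → ℕ) atTop atTop := by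
    rw [← prod_atTop_atTop_eq]; exact tendsto_snd
  have hxd := (tendsto_dist_of_not_mem_range (hX := hX) (ha := ha) (x := x) (hx ▸ ξ.2)).comp hfst
  have hyd := (tendsto_dist_of_not_mem_range (hX := hX) (ha := ha) (x := y) (hy ▸ η.2)).comp hsnd
  have hlim : Tendsto (fun mn : ℕ × ℕ => ‖L k (P (x.1 mn.1) - P (y.1 mn.2))‖) atTop
      (𝓝 ‖L k (p - q)‖) :=
    (((L k).continuous.tendsto _).comp
      (((hp x hx).comp hfst).sub ((hq y hy).comp hsnd))).norm
  have hR : ‖L k (p - q)‖ ≤ ‖L 1‖ := by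
    rw [show k = 1 + (k - 1) by ring, h.expanding.add]
    exact ((L 1).le_opNorm _).trans (mul_le_of_le_one_right (norm_nonneg _) hk1.le)
  -- The limit has norm at least 1; the bound 1/2 also shows the two vertices distinct, so ρ_a is
  -- not 0 by default.
  have hbig : ∀ᶠ mn : ℕ × ℕ in atTop, 1 / 2 ≤ ‖L k (P (x.1 mn.1) - P (y.1 mn.2))‖ :=
    hlim.eventually_const_le (by linarith)
  have hsmall : ∀ᶠ mn : ℕ × ℕ in atTop, ‖L (k - N) (P (x.1 mn.1) - P (y.1 mn.2))‖ < c := by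
    filter_upwards [hlim.eventually_le_const (show _ < ‖L 1‖ + 1 by linarith)] with mn hmn
    rw [show k - (N : ℤ) = -(N : ℤ) + k by ring, h.expanding.add]
    exact hN N le_rfl _ hmn
  have hprod := hlow (ℕ × ℕ) atTop (fun mn => x.1 mn.1) (fun mn => y.1 mn.2) (k - N) hxd hyd hsmall
  filter_upwards [hbig, hprod] with mn h1 h2
  constructor
  · refine exp_le_visual ha (fun he => ?_) ?_
    · rw [he, sub_self, map_zero, norm_zero] at h1
      linarith
    · by_contra! hlt
      have h3 := hC (x.1 mn.1) (y.1 mn.2) (k + M) (by push_cast; linarith [(Nat.cast_nonneg N : (0:ℝ) ≤ N)])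
      have := hM k (k + M) _ h1 h3
      omega
  · refine visual_le_exp ha ?_
    push_cast at h2
    linarith [(Nat.cast_nonneg M : (0 : ℝ) ≤ M)]

end Boundary

end HypGraph

/-! ### The pseudo-norm at a given scale. -/

namespace SelfAffine

variable {d : ℕ} {A : Matrix (Fin d) (Fin d) ℤ} {r : ℝ} {φ : EuclideanSpace ℝ (Fin d) → ℝ}

theorem annulus_eq (hA : Expanding A) :
    annulus A = (powMap A (-1) ⁻¹' Metric.ball 0 1) \ Metric.ball 0 1 := by
  have hL := hA.expandingGroup
  have h1 : ∀ x, Matrix.toEuclideanLin (realMat A) x = powMap A 1 x := fun x => by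
    rw [powMap_apply, zpow_one]
  rw [annulus]
  congr 1
  ext y
  constructor
  · rintro ⟨x, hx, rfl⟩
    rwa [Set.mem_preimage, h1, hL.neg_self]
  · exact fun hy => ⟨_, hy, by rw [h1, hL.self_neg]⟩

theorem mem_annulus (hA : Expanding A) {y : EuclideanSpace ℝ (Fin d)} :
    y ∈ annulus A ↔ ‖powMap A (-1) y‖ < 1 ∧ 1 ≤ ‖y‖ := by
  simp [annulus_eq hA]

theorem measurableSet_annulus (hA : Expanding A) : MeasurableSet (annulus A) := by
  rw [annulus_eq hA]
  exact (Metric.isOpen_ball.preimage (powMap A (-1)).continuous).measurableSet.diff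
    measurableSet_ball

theorem norm_le_of_mem_annulus (hA : Expanding A) {y : EuclideanSpace ℝ (Fin d)}
    (hy : y ∈ annulus A) : ‖y‖ ≤ ‖powMap A 1‖ := by
  rw [mem_annulus hA] at hy
  rw [← hA.expandingGroup.self_neg 1 y]
  exact ((powMap A 1).le_opNorm _).trans (mul_le_of_le_one_right (norm_nonneg _) hy.1.le)

theorem smoothedAnnulus_apply (A : Matrix (Fin d) (Fin d) ℤ) (φ : EuclideanSpace ℝ (Fin d) → ℝ)
    (y : EuclideanSpace ℝ (Fin d)) :
    smoothedAnnulus A φ y = ∫ t, (annulus A).indicator (fun t => φ (y - t)) t := by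
  rw [smoothedAnnulus, convolution_def]
  refine integral_congr_ae (Eventually.of_forall fun t => ?_)
  by_cases ht : t ∈ annulus A <;> simp [ht]

theorem IsBump.hasCompactSupport (hφ : IsBump r φ) : HasCompactSupport φ :=
  HasCompactSupport.of_support_subset_isCompact (isCompact_closedBall 0 r)
    (hφ.support_subset.trans Metric.ball_subset_closedBall)

theorem IsBump.continuous_smoothedAnnulus (hA : Expanding A) (hφ : IsBump r φ) :
    Continuous (smoothedAnnulus A φ) := by
  refine hφ.hasCompactSupport.continuous_convolution_right _ ?_ hφ.smooth.continuous
  exact (locallyIntegrable_const (1 : ℝ)).indicator (measurableSet_annulus hA)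

theorem IsBump.smoothedAnnulus_nonneg (hφ : IsBump r φ) (y : EuclideanSpace ℝ (Fin d)) :
    0 ≤ smoothedAnnulus A φ y := by
  rw [smoothedAnnulus_apply]
  exact integral_nonneg fun t => Set.indicator_nonneg (fun _ _ => hφ.nonneg _) _

theorem IsBump.norm_bounds_of_smoothedAnnulus_ne_zero (hA : Expanding A) (hφ : IsBump r φ)
    {y : EuclideanSpace ℝ (Fin d)} (hy : smoothedAnnulus A φ y ≠ 0) :
    1 / 2 ≤ ‖y‖ ∧ ‖y‖ ≤ ‖powMap A 1‖ + 1 := by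
  obtain ⟨t, ht, hyt⟩ : ∃ t ∈ annulus A, φ (y - t) ≠ 0 := by
    by_contra! h
    refine hy ?_
    rw [smoothedAnnulus_apply]
    exact integral_eq_zero_of_ae (Eventually.of_forall fun t => Set.indicator_apply_eq_zero.2 (h t))
  have h1 := hφ.support_subset hyt
  rw [mem_ball_zero_iff] at h1
  have h2 := norm_le_of_mem_annulus hA ht
  have h3 := ((mem_annulus hA).1 ht).2
  have h4 := hφ.radius_lt
  have h5 := norm_sub_norm_le y t
  have h6 := norm_sub_norm_le t y
  rw [norm_sub_rev] at h6
  constructor <;> linarith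

/-- The support of φ is open and accumulates at 0, so 0 itself can be avoided; z ≠ 0 gives a strict
inequality in the positivity of h. -/
theorem IsBump.exists_small (hd : 0 < d) (hφ : IsBump r φ) {ε : ℝ} (hε : 0 < ε) :
    ∃ z, z ≠ 0 ∧ ‖z‖ < ε ∧ 0 < φ z := by
  have : Nonempty (Fin d) := ⟨⟨0, hd⟩⟩
  have hopen : IsOpen (Function.support φ ∩ Metric.ball 0 ε) :=
    (hφ.smooth.continuous.isOpen_support).inter Metric.isOpen_ball
  have hne : (Function.support φ ∩ Metric.ball 0 ε).Nonempty := by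
    rw [Set.inter_comm]
    exact mem_closure_iff.1 hφ.zero_mem _ Metric.isOpen_ball (Metric.mem_ball_self hε)
  obtain ⟨z, ⟨hz1, hz2⟩, hz3⟩ :=
    (dense_compl_singleton (0 : EuclideanSpace ℝ (Fin d))).inter_open_nonempty _ hopen hne
  exact ⟨z, hz3, by simpa using hz2, (hφ.nonneg z).lt_of_ne' hz1⟩

/-- Since `φ` is even, one of two opposite small translations leaves the unit ball. -/
theorem IsBump.smoothedAnnulus_pos (hd : 0 < d) (hA : Expanding A) (hφ : IsBump r φ)
    {y : EuclideanSpace ℝ (Fin d)} (hy : y ∈ annulus A) : 0 < smoothedAnnulus A φ y := by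
  have hcont := hφ.smooth.continuous
  have hint : Integrable (fun t => (annulus A).indicator (fun t => φ (y - t)) t) := by
    refine Integrable.indicator ?_ (measurableSet_annulus hA)
    exact (hcont.integrable_of_hasCompactSupport hφ.hasCompactSupport).comp_sub_left y
  rw [smoothedAnnulus_apply, integral_pos_iff_support_of_nonneg
    (fun t => Set.indicator_nonneg (fun _ _ => hφ.nonneg _) _) hint]
  set U : Set (EuclideanSpace ℝ (Fin d)) := {t | ‖powMap A (-1) t‖ < 1} with hU
  have hUo : IsOpen U := isOpen_lt (by fun_prop) continuous_const
  -- The strict inequality 1 < ‖t‖ makes W open, so a single point of W already gives positive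
  -- measure.
  set W : Set (EuclideanSpace ℝ (Fin d)) := U ∩ {t | 1 < ‖t‖} ∩ {t | 0 < φ (y - t)} with hW
  have hWo : IsOpen W := (hUo.inter (isOpen_lt continuous_const continuous_norm)).inter
    (isOpen_lt continuous_const (by fun_prop))
  have hWs : W ⊆ Function.support (fun t => (annulus A).indicator (fun t => φ (y - t)) t) := by
    rintro t ⟨⟨h1, h2⟩, h3⟩
    have ht : t ∈ annulus A := (mem_annulus hA).2 ⟨h1, le_of_lt h2⟩
    rw [Function.mem_support, Set.indicator_of_mem ht]
    exact ne_of_gt h3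
  refine (hWo.measure_pos volume ?_).trans_le (measure_mono hWs)
  rw [mem_annulus hA] at hy
  obtain ⟨ε, hε, hεU⟩ := Metric.isOpen_iff.1 hUo y hy.1
  obtain ⟨z, hz0, hzε, hφz⟩ := hφ.exists_small hd hε
  -- As ‖y‖ ≥ 1 and z ≠ 0, ‖y + z‖² + ‖y - z‖² > 2, so one of y ± z lies strictly outside the unit
  -- ball.
  have hpar := parallelogram_law_with_norm ℝ y z
  have hzpos : 0 < ‖z‖ := norm_pos_iff.2 hz0
  rcases lt_or_ge 1 ‖y + z‖ with h | h
  · refine ⟨y + z, ⟨hεU (by simpa [dist_eq_norm] using hzε), h⟩, ?_⟩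
    rw [Set.mem_ofPred_eq, sub_add_cancel_left, hφ.even]
    exact hφz
  · refine ⟨y - z, ⟨hεU (by simpa [dist_eq_norm] using hzε), ?_⟩, ?_⟩
    · rw [Set.mem_ofPred_eq]
      by_contra! h'
      nlinarith [norm_nonneg (y + z), norm_nonneg (y - z), hy.2, mul_pos hzpos hzpos]
    · rw [Set.mem_ofPred_eq, sub_sub_cancel]
      exact hφz

theorem pseudoNorm_eq (hA : Expanding A) (φ : EuclideanSpace ℝ (Fin d) → ℝ)
    (x : EuclideanSpace ℝ (Fin d)) :
    pseudoNorm A φ x = ∑' n : ℤ, Real.exp (-(Real.log |(A.det : ℝ)| / d) * n) *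
      smoothedAnnulus A φ (powMap A n x) := by
  have hq : 0 < |(A.det : ℝ)| := abs_pos.2 (by exact_mod_cast hA.det_ne_zero)
  refine tsum_congr fun n => ?_
  rw [Real.rpow_def_of_pos hq, powMap_apply]
  congr 2
  ring

/-- Shifting the summation index by k; this reduces all estimates to one compact shell. -/
theorem pseudoNorm_powMap (hA : Expanding A) (φ : EuclideanSpace ℝ (Fin d) → ℝ) (k : ℤ)
    (x : EuclideanSpace ℝ (Fin d)) :
    pseudoNorm A φ x = Real.exp (-(Real.log |(A.det : ℝ)| / d) * k) *
      pseudoNorm A φ (powMap A k x) := by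
  rw [pseudoNorm_eq hA, pseudoNorm_eq hA, ← tsum_mul_left, ← (Equiv.addRight k).tsum_eq]
  refine tsum_congr fun n => ?_
  rw [Equiv.coe_addRight, hA.expandingGroup.add, ← mul_assoc, ← Real.exp_add]
  push_cast
  ring_nf

/-- On an annulus the pseudo-norm is a finite sum over a fixed range. -/
theorem IsBump.exists_pseudoNorm_eq_sum (hA : Expanding A) (hφ : IsBump r φ) (R : ℝ) :
    ∃ F : Finset ℤ, ∀ x : EuclideanSpace ℝ (Fin d), 1 ≤ ‖x‖ → ‖x‖ ≤ R →
      (∀ n ∉ F, smoothedAnnulus A φ (powMap A n x) = 0) ∧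
      pseudoNorm A φ x = ∑ n ∈ F, Real.exp (-(Real.log |(A.det : ℝ)| / d) * n) *
        smoothedAnnulus A φ (powMap A n x) := by
  have hL := hA.expandingGroup
  obtain ⟨N, hN⟩ := hL.exists_nat_lt (max R (‖powMap A 1‖ + 1)) (one_half_pos (α := ℝ))
  refine ⟨Finset.Ioo (-N : ℤ) N, fun x hx1 hx2 => ?_⟩
  have hzero : ∀ n ∉ Finset.Ioo (-N : ℤ) N, smoothedAnnulus A φ (powMap A n x) = 0 := by
    intro n hn
    by_contra hne
    obtain ⟨h1, h2⟩ := hφ.norm_bounds_of_smoothedAnnulus_ne_zero hA hne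
    -- The same estimate with 0 and n exchanged bounds n from both sides.
    have h3 := hN 0 n x (by rw [hL.zero_apply]; linarith) (h2.trans (le_max_right _ _))
    have h4 := hN n 0 x h1 (by rw [hL.zero_apply]; exact hx2.trans (le_max_left _ _))
    exact hn (Finset.mem_Ioo.2 ⟨by omega, by omega⟩)
  refine ⟨hzero, ?_⟩
  rw [pseudoNorm_eq hA]
  exact tsum_eq_sum fun n hn => by rw [hzero n hn, mul_zero]

theorem IsBump.exists_pseudoNorm_bounds (hd : 0 < d) (hA : Expanding A) (hφ : IsBump r φ) :
    ∃ C : ℝ, 0 < C ∧ ∀ (x : EuclideanSpace ℝ (Fin d)) (k : ℤ),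
      ‖powMap A (k - 1) x‖ < 1 → 1 ≤ ‖powMap A k x‖ →
        C⁻¹ * Real.exp (-(Real.log |(A.det : ℝ)| / d) * k) ≤ pseudoNorm A φ x ∧
          pseudoNorm A φ x ≤ C * Real.exp (-(Real.log |(A.det : ℝ)| / d) * k) := by
  have hL := hA.expandingGroup
  set S : Set (EuclideanSpace ℝ (Fin d)) :=
    Metric.closedBall 0 ‖powMap A 1‖ ∩ {x | 1 ≤ ‖x‖} with hS
  have hSc : IsCompact S := (isCompact_closedBall _ _).inter_right
    (isClosed_le continuous_const continuous_norm)
  obtain ⟨F, hF⟩ := hφ.exists_pseudoNorm_eq_sum hA ‖powMap A 1‖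
  have hcont := hφ.continuous_smoothedAnnulus hA
  have hcontS : ContinuousOn (pseudoNorm A φ) S := by
    refine ContinuousOn.congr (f := fun x => ∑ n ∈ F, Real.exp (-(Real.log |(A.det : ℝ)| / d) * n) *
        smoothedAnnulus A φ (powMap A n x)) ?_
      fun x hx => (hF x hx.2 (mem_closedBall_zero_iff.1 hx.1)).2
    refine Continuous.continuousOn (continuous_finsetSum _ fun n _ => ?_)
    exact continuous_const.mul (hcont.comp (powMap A n).continuous)
  have hpos : ∀ x ∈ S, 0 < pseudoNorm A φ x := by
    intro x hx
    have hx0 : x ≠ 0 := by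
      rintro rfl
      have h0 : (1 : ℝ) ≤ ‖(0 : EuclideanSpace ℝ (Fin d))‖ := hx.2
      rw [norm_zero] at h0
      linarith
    -- Some iterate of x lies in V, where h is positive, so one term of the sum is positive.
    obtain ⟨k, hk1, hk2⟩ := hL.exists_scale hx0
    have hkpos : 0 < smoothedAnnulus A φ (powMap A k x) := by
      refine hφ.smoothedAnnulus_pos hd hA ((mem_annulus hA).2 ⟨?_, hk2⟩)
      rwa [← hL.add, neg_add_eq_sub]
    obtain ⟨hzero, hsum⟩ := hF x hx.2 (mem_closedBall_zero_iff.1 hx.1)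
    rw [hsum]
    refine Finset.sum_pos' (fun n _ => mul_nonneg (Real.exp_pos _).le
      (hφ.smoothedAnnulus_nonneg _)) ⟨k, ?_, mul_pos (Real.exp_pos _) hkpos⟩
    by_contra hkF
    exact hkpos.ne' (hzero k hkF)
  obtain ⟨C, hC, hCS⟩ : ∃ C : ℝ, 0 < C ∧ ∀ x ∈ S, C⁻¹ ≤ pseudoNorm A φ x ∧ pseudoNorm A φ x ≤ C := by
    rcases S.eq_empty_or_nonempty with he | hne
    · exact ⟨1, one_pos, by simp [he]⟩
    obtain ⟨m, hm, hmin⟩ := hSc.exists_isMinOn hne hcontS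
    obtain ⟨M, hM, hmax⟩ := hSc.exists_isMaxOn hne hcontS
    have hm0 := hpos m hm
    refine ⟨max (pseudoNorm A φ M) (pseudoNorm A φ m)⁻¹, lt_max_of_lt_left (hpos M hM),
      fun x hx => ⟨?_, (hmax hx).trans (le_max_left _ _)⟩⟩
    refine (inv_anti₀ (inv_pos.2 hm0) (le_max_right _ _)).trans ?_
    rw [inv_inv]
    exact hmin hx
  refine ⟨C, hC, fun x k hk1 hk2 => ?_⟩
  have hmem : powMap A k x ∈ S := by
    refine ⟨mem_closedBall_zero_iff.2 (norm_le_of_mem_annulus hA ?_), hk2⟩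
    rw [mem_annulus hA, ← hL.add, neg_add_eq_sub]
    exact ⟨hk1, hk2⟩
  obtain ⟨h1, h2⟩ := hCS _ hmem
  rw [pseudoNorm_powMap hA φ k x, mul_comm C⁻¹, mul_comm C]
  exact ⟨by gcongr, by gcongr⟩

end SelfAffine

end

/-! ### Comparing both sides at the common scale. -/

theorem mainTheorem1 {d : ℕ} (hd : 0 < d)
    (A : Matrix (Fin d) (Fin d) ℤ) (hA : SelfAffine.Expanding A)
    (D : Finset (Fin d → ℤ)) (hD : D.Nonempty)
    (K : Set (EuclideanSpace ℝ (Fin d))) (hK : SelfAffine.IsSelfAffineSet A D K)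
    (J : Set (EuclideanSpace ℝ (Fin d))) (hJ : SelfAffine.IsInvariantSet A D J)
    (r : ℝ) (φ : EuclideanSpace ℝ (Fin d) → ℝ) (hφ : SelfAffine.IsBump r φ)
    (q : ℝ) (hq : |(A.det : ℝ)| = q) :
    ∃ hX : HypGraph.Hyperbolic (SelfAffine.symbolicGraph A D J) (SelfAffine.root A D),
      ∀ δ : ℝ,
        HypGraph.HyperbolicWith (SelfAffine.symbolicGraph A D J) (SelfAffine.root A D) δ →
        ∀ (a : ℝ) (ha : 0 < a), Real.exp (3 * δ * a) < Real.sqrt 2 →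
          ∃ Φ : HypGraph.Boundary hX ha → K, Function.Bijective Φ ∧
            ∃ C : ℝ, 0 < C ∧ ∀ ξ η : HypGraph.Boundary hX ha, ξ ≠ η →
              C⁻¹ * SelfAffine.pseudoNorm A φ ((Φ ξ : EuclideanSpace ℝ (Fin d)) - Φ η) ≤
                  HypGraph.visualExt hX ha ξ.1 η.1 ^ (Real.log q / (d * a)) ∧
                HypGraph.visualExt hX ha ξ.1 η.1 ^ (Real.log q / (d * a)) ≤
                  C * SelfAffine.pseudoNorm A φ ((Φ ξ : EuclideanSpace ℝ (Fin d)) - Φ η) := by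
  obtain ⟨κ, hκ⟩ := hK.1
  have hcode := SelfAffine.isCoding_symbolicGraph hd hA hJ (hK.subset hA hJ hκ)
  refine ⟨hcode.hyperbolic, fun δ _ a ha _ => ?_⟩
  obtain ⟨Φ, hbij, hΦ⟩ := hcode.exists_boundaryMap (hX := hcode.hyperbolic) (ha := ha) hK.2.1
    (fun x => hK.vertex_map_mem hκ x) fun p hp => hK.exists_vertex_tendsto hd hA hJ.2.2.2 κ hp
  obtain ⟨c, hc⟩ := hcode.exists_visualExt_bounds (hX := hcode.hyperbolic)
  obtain ⟨C, hC, hw⟩ := hφ.exists_pseudoNorm_bounds hd hA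
  have hq1 : 1 ≤ q := by
    rw [← hq]
    exact_mod_cast Int.one_le_abs hA.det_ne_zero
  rw [hq] at hw
  set β : ℝ := Real.log q / d with hβ
  have hα : Real.log q / (d * a) = β / a := by rw [hβ, div_div]
  have hα0 : 0 ≤ β / a := div_nonneg (div_nonneg (Real.log_nonneg hq1) d.cast_nonneg) ha.le
  -- C comes from the pseudo-norm; e^(βc) is the α-th power of e^(ac), the error of the visual
  -- metric.
  refine ⟨Φ, hbij, C * Real.exp (β * c), by positivity, fun ξ η hne => ?_⟩
  set v : EuclideanSpace ℝ (Fin d) := (Φ ξ : EuclideanSpace ℝ (Fin d)) - Φ η with hv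
  have hv0 : v ≠ 0 := fun h => hne (hbij.1 (Subtype.ext (sub_eq_zero.1 h)))
  obtain ⟨k, hk1, hk2⟩ := hA.expandingGroup.exists_scale hv0
  obtain ⟨hw1, hw2⟩ := hw v k hk1 hk2
  obtain ⟨h1, h2⟩ := hc ξ η (Φ ξ) (Φ η) k (hΦ ξ) (hΦ η) hk1 hk2
  have hpow : ∀ s : ℝ, Real.exp (-a * s) ^ (β / a) = Real.exp (-β * s) := fun s => by
    rw [← Real.exp_mul]
    congr 1
    field_simp
  have h1' := Real.rpow_le_rpow (Real.exp_pos _).le h1 hα0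
  have h2' := Real.rpow_le_rpow ((Real.exp_pos _).le.trans h1) h2 hα0
  rw [hpow] at h1' h2'
  rw [hα]
  constructor
  · refine le_trans ?_ h1'
    rw [mul_inv, ← Real.exp_neg, mul_assoc, mul_left_comm]
    calc Real.exp (-(β * c)) * (C⁻¹ * SelfAffine.pseudoNorm A φ v)
        ≤ Real.exp (-(β * c)) * (C⁻¹ * (C * Real.exp (-β * k))) := by gcongr
      _ = Real.exp (-β * (k + c)) := by
        rw [inv_mul_cancel_left₀ hC.ne', ← Real.exp_add]
        ring_nf
  · refine h2'.trans ?_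
    calc Real.exp (-β * (k - c)) = C * Real.exp (β * c) * (C⁻¹ * Real.exp (-β * k)) := by
          rw [mul_mul_mul_comm, mul_inv_cancel₀ hC.ne', one_mul, ← Real.exp_add]
          ring_nf
      _ ≤ C * Real.exp (β * c) * SelfAffine.pseudoNorm A φ v := by gcongr
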